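/- Let $0<\lambda_1,\lambda_2<1$, $0\le p_1<1$, $0\le p_2\le 1$. Two queues share a slotted collision channel. At the start of each slot a packet arrives at queue $i$ with probability $\lambda_i$; queue $i$ decides to access the channel with probability $p_i$; all arrivals and decisions are independent. In an ON slot queue 1 transmits if it decides to (sending a dummy packet if it is empty: queue 1 is always backlogged), and queue 2 transmits if it decides to and is nonempty, counting a packet that has just arrived. A packet leaves its queue if only that queue transmits; if both transmit, nothing is delivered and the next slot is OFF. In an OFF slot queue 2 is silent and queue 1 transmits with probability 1; the next slot is ON. Let $(k,\mathrm{ON})$, $(k,\mathrm{OFF})$ be the states of queue 2 (length $k$ and kind of slot); the system state consists of the length of queue 1 (true packets only) and the state of queue 2. A Markov chain started at $x_0$ is called stable if every state reachable from $x_0$ is positive recurrent; the chains below start with empty queues in an ON slot. Then: (1) Whatever queue 1 contains, queue 2 evolves as a Markov chain of its own. It is a homogeneous quasi-birth-death chain: with the two phases ordered (ON, OFF) and matrix entries $(i,j)$ giving the probability of moving from phase $j$ to phase $i$, its boundary, down, local and up blocks are $$B=\begin{pmatrix}1-\lambda_2+\lambda_2(1-p_1)p_2&1-\lambda_2\\0&0\end{pmatrix},\quad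 A_0=\begin{pmatrix}(1-\lambda_2)(1-p_1)p_2&0\\0&0\end{pmatrix},$$ $$A_1=\begin{pmatrix}\lambda_2p_2(1-p_1)+(1-\lambda_2)(1-p_2)&1-\lambda_2\\(1-\lambda_2)p_1p_2&0\end{pmatrix},\quad A_2=\begin{pmatrix}\lambda_2(1-p_2)&\lambda_2\\\lambda_2p_1p_2&0\end{pmatrix}.$$ (2) If $p_2>0$, the matrix $$R=\begin{pmatrix}\frac{\lambda_2(1-p_2+p_1p_2)}{(1-\lambda_2)(1-p_1)p_2}&\frac{\lambda_2}{(1-\lambda_2)(1-p_1)p_2}\\[2pt]\frac{\lambda_2p_1}{1-p_1}&\frac{\lambda_2p_1}{1-p_1}\end{pmatrix}$$ satisfies $A_2+(A_1-I)R+A_0R^2=0$, and its spectral radius is $$\mathrm{sp}(R)=\frac{\lambda_2\left(1-p_2-\lambda_2p_1p_2+2p_1p_2+\sqrt{1-2p_2+p_2^2+4p_1p_2-2\lambda_2p_1p_2-2\lambda_2p_1p_2^2+\lambda_2^2p_1^2p_2^2}\right)}{2p_2(1-\lambda_2-p_1+\lambda_2p_1)}.$$ The queue 2 chain is stable if and only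 if $\mathrm{sp}(R)<1$, and this holds if and only if $\lambda_2<\frac{p_2(1-p_1)}{1+p_1p_2}$. (3) For all $p_2\in[0,1]$, the queue 2 chain is stable if and only if $\lambda_2<\frac{p_2(1-p_1)}{1+p_1p_2}$, if and only if it has a stationary distribution. In this case $R$ is its rate matrix, i.e. the entrywise smallest entrywise nonnegative solution of the equation in (2). Any stationary distribution $v$ satisfies $v_k=R^kv_0$, where $v_k=(v(k,\mathrm{ON}),v(k,\mathrm{OFF}))^T$, and $$v_0=\left(\frac{p_2-\lambda_2-p_1p_2-\lambda_2p_1p_2}{(1-\lambda_2)(1-p_1)p_2},\,0\right)^T,$$ and under $v$ the service rate of queue 1 (the probability that it transmits without collision in a slot) is $\mu_1'=\frac{p_1(1-p_1-\lambda_2p_1)}{1-p_1}$. (4) The whole system is stable if and only if $$\lambda_1<\frac{p_1(1-p_1-\lambda_2p_1)}{1-p_1}\quad\text{and}\quad\lambda_2<\frac{p_2(1-p_1)}{1+p_1p_2}.$$ -/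

import Mathlib

open scoped ENNReal

namespace DomSys

/-! ### Countable-state Markov chains

A chain is given by `P : S → S → ℝ`, where `P x y` is the one-step probability of going
from `x` to `y`. -/

section Chain

variable {S : Type*} [DecidableEq S]

/-- `firstHit P x n y` is the probability that the chain started at `y` visits `x` for the
first time (among the times `1, 2, 3, …`) at time `n + 1`. -/
noncomputable def firstHit (P : S → S → ℝ) (x : S) : ℕ → S → ℝ≥0∞
  | 0, y => ENNReal.ofReal (P y x)
  | n + 1, y => ∑' z, if z = x then 0 else ENNReal.ofReal (P y z) * firstHit P x n z

/-- The state `x` is positive recurrent: the chain started at `x` returns to `x` with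
probability one, and the mean return time is finite. -/
def PositiveRecurrent (P : S → S → ℝ) (x : S) : Prop :=
  ∑' n, firstHit P x n x = 1 ∧ ∑' n : ℕ, ((n : ℝ≥0∞) + 1) * firstHit P x n x ≠ ∞

/-- `y` can be reached from `x` in finitely many (possibly zero) steps. -/
def Reachable (P : S → S → ℝ) (x y : S) : Prop :=
  Relation.ReflTransGen (fun a b => 0 < P a b) x y

/-- The chain started at `x₀` is stable: every state that it can ever enter is positive
recurrent. -/
def Stable (P : S → S → ℝ) (x₀ : S) : Prop :=
  ∀ y, Reachable P x₀ y → PositiveRecurrent P y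

/-- `v` is a stationary probability distribution of the chain. -/
def IsStationary (P : S → S → ℝ) (v : S → ℝ) : Prop :=
  (∀ x, 0 ≤ v x) ∧ HasSum v 1 ∧ ∀ y, HasSum (fun x => v x * P x y) (v y)

end Chain

/-! ### The queueing system with queue 1 always backlogged -/

/-- The random inputs of one slot: the arrivals at the two queues and the access decisions
of the two queues. -/
structure Slot where
  /-- a packet arrives at queue 1 at the start of the slot -/
  a₁ : Bool
  /-- a packet arrives at queue 2 at the start of the slot -/
  a₂ : Bool
  /-- the random-access decision of queue 1 is to transmit -/
  t₁ : Bool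
  /-- the random-access decision of queue 2 is to transmit -/
  t₂ : Bool

/-- The probability that a Bernoulli variable of mean `p` takes the value `b`. -/
def bern (p : ℝ) (b : Bool) : ℝ := if b then p else 1 - p

/-- The probability of a slot input: the four inputs are independent Bernoulli variables. -/
def Slot.prob (l₁ l₂ p₁ p₂ : ℝ) (ω : Slot) : ℝ :=
  bern l₁ ω.a₁ * bern l₂ ω.a₂ * bern p₁ ω.t₁ * bern p₂ ω.t₂

/-- The probability of an event on one slot. -/
def slotProb (l₁ l₂ p₁ p₂ : ℝ) (E : Slot → Prop) [DecidablePred E] : ℝ :=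
  ∑ a₁ : Bool, ∑ a₂ : Bool, ∑ t₁ : Bool, ∑ t₂ : Bool,
    if E ⟨a₁, a₂, t₁, t₂⟩ then Slot.prob l₁ l₂ p₁ p₂ ⟨a₁, a₂, t₁, t₂⟩ else 0

/-- State of queue 2: its length, and its mode (`0` is ON, `1` is OFF: the slot following a
collision, in which queue 2 backs off and queue 1 retransmits). -/
abbrev State₂ : Type := ℕ × Fin 2

/-- State of the whole system: the length of queue 1 (true packets only) and the state of
queue 2. -/
abbrev State : Type := ℕ × State₂

/-- Queue 1 transmits. It always has something to send (a dummy packet if it is empty), and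
it retransmits with certainty in an OFF slot. -/
def tx₁ (z : State₂) (ω : Slot) : Bool := z.2 == 1 || ω.t₁

/-- Queue 2 transmits: it is not backing off, it is nonempty (counting an arrival at the
start of the slot), and it decides to access the channel. -/
def tx₂ (z : State₂) (ω : Slot) : Bool := z.2 == 0 && decide (0 < z.1 + ω.a₂.toNat) && ω.t₂

/-- Queue 1 transmits without collision. -/
def served₁ (z : State₂) (ω : Slot) : Bool := tx₁ z ω && !tx₂ z ω

/-- Queue 2 transmits without collision. -/
def served₂ (z : State₂) (ω : Slot) : Bool := tx₂ z ω && !tx₁ z ω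

/-- The state of queue 2 after one slot; a collision is followed by an OFF slot. -/
def next₂ (z : State₂) (ω : Slot) : State₂ :=
  (z.1 + ω.a₂.toNat - (served₂ z ω).toNat, if tx₁ z ω && tx₂ z ω then 1 else 0)

/-- The state of the system after one slot; the truncated subtraction accounts for the slots
in which queue 1 successfully sends a dummy packet. -/
def next (x : State) (ω : Slot) : State :=
  (x.1 + ω.a₁.toNat - (served₁ x.2 ω).toNat, next₂ x.2 ω)

/-- Transition probabilities of the whole system. -/
def sysTrans (l₁ l₂ p₁ p₂ : ℝ) (x y : State) : ℝ :=
  slotProb l₁ l₂ p₁ p₂ (fun ω => next x ω = y)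

/-- Transition probabilities of queue 2. (They do not depend on the arrivals at queue 1,
whose rate is set to `0` here.) -/
def trans₂ (l₂ p₁ p₂ : ℝ) (z z' : State₂) : ℝ :=
  slotProb 0 l₂ p₁ p₂ (fun ω => next₂ z ω = z')

/-- The probability that queue 1 is served in a slot at whose start queue 2 is in state `z`. -/
def serviceProb₁ (l₂ p₁ p₂ : ℝ) (z : State₂) : ℝ :=
  slotProb 0 l₂ p₁ p₂ (fun ω => served₁ z ω = true)

/-! ### Quasi-birth-death structure

Blocks are written in the column convention: the entry `(i, j)` is the probability of moving
from phase `j` to phase `i`. -/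

/-- `P` is a homogeneous quasi-birth-death chain with boundary block `B`, down-block `A₀`,
local block `A₁` and up-block `A₂`. -/
def IsHomogeneousQBD (P : State₂ → State₂ → ℝ) (B A₀ A₁ A₂ : Matrix (Fin 2) (Fin 2) ℝ) : Prop :=
  ∀ i j : Fin 2,
    P (0, j) (0, i) = B i j ∧
    (∀ k, P (k + 1, j) (k, i) = A₀ i j) ∧
    (∀ k, P (k + 1, j) (k + 1, i) = A₁ i j) ∧
    (∀ k, P (k, j) (k + 1, i) = A₂ i j) ∧
    (∀ k m, k + 1 < m ∨ m + 1 < k → P (k, j) (m, i) = 0)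

/-- The boundary block. -/
def blockB (l₂ p₁ p₂ : ℝ) : Matrix (Fin 2) (Fin 2) ℝ :=
  !![(1 - l₂) + l₂ * (1 - p₁) * p₂, 1 - l₂; 0, 0]

/-- One level down. -/
def blockA₀ (l₂ p₁ p₂ : ℝ) : Matrix (Fin 2) (Fin 2) ℝ :=
  !![(1 - l₂) * (1 - p₁) * p₂, 0; 0, 0]

/-- Same level. -/
def blockA₁ (l₂ p₁ p₂ : ℝ) : Matrix (Fin 2) (Fin 2) ℝ :=
  !![l₂ * p₂ * (1 - p₁) + (1 - l₂) * (1 - p₂), 1 - l₂; (1 - l₂) * p₁ * p₂, 0]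

/-- One level up. -/
def blockA₂ (l₂ p₁ p₂ : ℝ) : Matrix (Fin 2) (Fin 2) ℝ :=
  !![l₂ * (1 - p₂), l₂; l₂ * p₁ * p₂, 0]

/-- The matrix equation of the rate matrix: if `v_{k+1} = X v_k` for all `k`, it turns into
the balance equations `v_{k+1} = A₂ v_k + A₁ v_{k+1} + A₀ v_{k+2}`. -/
def SolvesRateEquation (A₀ A₁ A₂ X : Matrix (Fin 2) (Fin 2) ℝ) : Prop :=
  A₂ + (A₁ - 1) * X + A₀ * X ^ 2 = 0

/-- The rate matrix of a quasi-birth-death chain: the entrywise smallest entrywise nonnegative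
solution of the rate equation. -/
def IsRateMatrix (A₀ A₁ A₂ R : Matrix (Fin 2) (Fin 2) ℝ) : Prop :=
  (∀ i j, 0 ≤ R i j) ∧ SolvesRateEquation A₀ A₁ A₂ R ∧
    ∀ X : Matrix (Fin 2) (Fin 2) ℝ, (∀ i j, 0 ≤ X i j) → SolvesRateEquation A₀ A₁ A₂ X →
      ∀ i j, R i j ≤ X i j

/-- The explicit matrix `R`. -/
noncomputable def rateR (l₂ p₁ p₂ : ℝ) : Matrix (Fin 2) (Fin 2) ℝ :=
  !![l₂ * (1 - p₂ + p₁ * p₂) / ((1 - l₂) * (1 - p₁) * p₂), l₂ / ((1 - l₂) * (1 - p₁) * p₂);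
     l₂ * p₁ / (1 - p₁), l₂ * p₁ / (1 - p₁)]

/-- The spectral radius of a real matrix: the maximal modulus of its complex eigenvalues. -/
noncomputable def sp (M : Matrix (Fin 2) (Fin 2) ℝ) : ℝ≥0∞ :=
  spectralRadius ℂ (M.map (fun x : ℝ => (x : ℂ)))

end DomSys

/-! For a chain on a countable set, every state reachable from x₀ is positive recurrent exactly when
some stationary distribution charges x₀ (`stable_iff_exists_isStationary`): Kac's lemma gives one
direction, the occupation measure of a return cycle the other. All stability claims thus become
claims about invariant measures.

For queue 2, the flow across the cut between levels k and k+1 and the flow into an OFF state give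
two linear recurrences, equivalent to v_{k+1} = R v_k. Since v(0,OFF) = 0, a stationary law is
determined by v(0,ON), and normalisation forces (1-λ₂)(1-p₁)p₂ v(0,ON) = κ, where κ =
p₂-λ₂-p₁p₂-λ₂p₁p₂. Hence κ > 0 is necessary. It is also sufficient: a weighted level sum telescopes
and shows that R^k v₀ is summable with total mass 1. Up to a positive factor, κ is also det(I-R),
which links it to sp(R) < 1.

The service rate of queue 1 does not depend on p₂: in equilibrium queue 2 delivers packets at rate
λ₂, and each of its attempts collides with probability p₁, so collisions, and therefore OFF slots,
have frequency λ₂p₁/(1-p₁). Queue 1 succeeds at rate p₁ times the frequency of ON slots.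

For the whole system, the marginal of a stationary law on queue 2 is stationary, and flow balance in
queue 1 reads λ₁ + (rate of wasted dummy packets) = μ₁' (`IsStationary.arrival_add_dummy`). The
dummy rate is positive when the origin is charged, so λ₁ < μ₁'. Conversely, start with queue 1 empty
and queue 2 stationary. The mean of queue 1 stays nonnegative, so dummies are sent at average rate
at least μ₁'-λ₁; since queue 2 is tight, the system spends a positive fraction of time in a finite
set. A compactness argument (`exists_isStationary_of_le_sum`) then yields a stationary law. -/

namespace DomSys

/-! ### Invariant measures of countable Markov chains. -/

section ChainTheory

open Filter Topology

variable {S : Type*}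

/-- A transition matrix: nonnegative entries and unit row sums. -/
structure IsStochastic (P : S → S → ℝ) : Prop where
  nonneg : ∀ x y, 0 ≤ P x y
  hasSum : ∀ x, HasSum (P x) 1

theorem IsStochastic.tsum_ofReal {P : S → S → ℝ} (hP : IsStochastic P) (x : S) :
    ∑' y, ENNReal.ofReal (P x y) = 1 := by
  rw [← ENNReal.ofReal_tsum_of_nonneg (hP.nonneg x) (hP.hasSum x).summable, (hP.hasSum x).tsum_eq,
    ENNReal.ofReal_one]

theorem IsStochastic.tsum_tsum_mul {P : S → S → ℝ} (hP : IsStochastic P) (W : S → ℝ≥0∞) :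
    ∑' y, ∑' x, W x * ENNReal.ofReal (P x y) = ∑' x, W x := by
  rw [ENNReal.tsum_comm]
  simp_rw [ENNReal.tsum_mul_left, hP.tsum_ofReal, mul_one]

theorem IsStationary.tsum_ofReal {P : S → S → ℝ} {v : S → ℝ} (hv : IsStationary P v) :
    ∑' x, ENNReal.ofReal (v x) = 1 := by
  rw [← ENNReal.ofReal_tsum_of_nonneg hv.1 hv.2.1.summable, hv.2.1.tsum_eq, ENNReal.ofReal_one]

theorem IsStationary.tsum_mul {P : S → S → ℝ} (hP : IsStochastic P) {v : S → ℝ}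
    (hv : IsStationary P v) (y : S) :
    ∑' x, ENNReal.ofReal (v x) * ENNReal.ofReal (P x y) = ENNReal.ofReal (v y) := by
  simp_rw [← ENNReal.ofReal_mul (hv.1 _)]
  rw [← ENNReal.ofReal_tsum_of_nonneg (fun x => mul_nonneg (hv.1 x) (hP.nonneg x y))
    (hv.2.2 y).summable, (hv.2.2 y).tsum_eq]

theorem isStationary_toReal {P : S → S → ℝ} (hP : IsStochastic P) {W : S → ℝ≥0∞}
    (h1 : ∑' x, W x = 1) (hinv : ∀ y, ∑' x, W x * ENNReal.ofReal (P x y) = W y) :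
    IsStationary P (fun x => (W x).toReal) := by
  have hfin : ∀ x, W x ≠ ∞ := fun x =>
    ENNReal.ne_top_of_tsum_ne_top (h1 ▸ ENNReal.one_ne_top) x
  refine ⟨fun x => ENNReal.toReal_nonneg, ?_, fun y => ?_⟩
  · have := ENNReal.hasSum_toReal (f := W) (by rw [h1]; exact ENNReal.one_ne_top)
    rwa [← ENNReal.tsum_toReal_eq hfin, h1, ENNReal.toReal_one] at this
  · have hne : ∑' x, W x * ENNReal.ofReal (P x y) ≠ ∞ := by rw [hinv]; exact hfin y
    have := ENNReal.hasSum_toReal hne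
    rw [← ENNReal.tsum_toReal_eq (fun x => ENNReal.ne_top_of_tsum_ne_top hne x), hinv] at this
    simpa [ENNReal.toReal_mul, ENNReal.toReal_ofReal (hP.nonneg _ _)] using this

/-- A finite nonzero invariant measure can be normalised to a stationary distribution. -/
theorem exists_isStationary_of_invariant {P : S → S → ℝ} (hP : IsStochastic P) {W : S → ℝ≥0∞}
    (h0 : ∑' x, W x ≠ 0) (htop : ∑' x, W x ≠ ∞)
    (hinv : ∀ y, ∑' x, W x * ENNReal.ofReal (P x y) = W y) :
    ∃ v, IsStationary P v ∧ ∀ x, W x ≠ 0 → 0 < v x := by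
  set c := ∑' x, W x with hc
  have hW : ∀ x, W x ≠ ∞ := fun x => ENNReal.ne_top_of_tsum_ne_top htop x
  refine ⟨fun x => (W x / c).toReal, isStationary_toReal hP ?_ fun y => ?_, fun x hx =>
    ENNReal.toReal_pos (ENNReal.div_pos hx htop).ne' (ENNReal.div_ne_top (hW x) h0)⟩
  · simp_rw [div_eq_mul_inv, ENNReal.tsum_mul_right]
    exact ENNReal.mul_inv_cancel h0 htop
  · rw [← hinv y]
    simp_rw [div_eq_mul_inv, mul_right_comm _ c⁻¹, ENNReal.tsum_mul_right]

/-- One step of the chain preserves total mass, so a strict inequality at a single point would make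
a finite mass smaller than itself. -/
theorem invariant_of_subinvariant {P : S → S → ℝ} (hP : IsStochastic P) {W : S → ℝ≥0∞}
    (htop : ∑' x, W x ≠ ∞) (hsub : ∀ y, ∑' x, W x * ENNReal.ofReal (P x y) ≤ W y) (y : S) :
    ∑' x, W x * ENNReal.ofReal (P x y) = W y := by
  by_contra h
  have hlt := lt_of_le_of_ne (hsub y) h
  have := ENNReal.tsum_lt_tsum (f := fun y => ∑' x, W x * ENNReal.ofReal (P x y)) (g := W)
    (by rw [hP.tsum_tsum_mul]; exact htop) hsub hlt
  rw [hP.tsum_tsum_mul] at this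
  exact lt_irrefl _ this

theorem IsStationary.pos_of_reachable {P : S → S → ℝ} (hP : IsStochastic P) {v : S → ℝ}
    (hv : IsStationary P v) {x y : S} (hx : 0 < v x) (h : Reachable P x y) : 0 < v y := by
  unfold Reachable at h
  induction h with
  | refl => exact hx
  | tail _ hstep ih =>
    rename_i b c _
    have h1 := le_hasSum (hv.2.2 c) b (fun z _ => mul_nonneg (hv.1 z) (hP.nonneg z c))
    exact (mul_pos ih hstep).trans_le h1

/-- The mean of a return time as the sum of its tails. Index n of `firstHit` stands for time n + 1,
whence the weight. -/
theorem tsum_tsum_add (f : ℕ → ℝ≥0∞) :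
    ∑' n, ∑' j, f (j + n) = ∑' n : ℕ, ((n : ℝ≥0∞) + 1) * f n := by
  have h : ∑' n, ∑' j, f (j + n) = ∑' p : ℕ × ℕ, f (p.2 + p.1) := ENNReal.tsum_prod.symm
  rw [h, ← (Finset.HasAntidiagonal.sigmaAntidiagonalEquivProd (A := ℕ)).tsum_eq, ENNReal.tsum_sigma']
  refine tsum_congr fun n => ?_
  have h' : ∀ p : Finset.HasAntidiagonal.antidiagonal n,
      f ((Finset.HasAntidiagonal.sigmaAntidiagonalEquivProd ⟨n, p⟩).2
        + (Finset.HasAntidiagonal.sigmaAntidiagonalEquivProd ⟨n, p⟩).1) = f n := by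
    intro p
    rw [add_comm]
    exact congrArg f (Finset.HasAntidiagonal.mem_antidiagonal.1 p.2)
  simp_rw [h', tsum_fintype]
  simp

/-! ### Positive recurrence and stationary distributions. -/

section FirstHit

variable [DecidableEq S]

/-- The probability that the chain started at `y` avoids `x` at the times `1, …, n`. -/
noncomputable def avoid (P : S → S → ℝ) (x : S) : ℕ → S → ℝ≥0∞
  | 0, _ => 1
  | n + 1, y => ∑' z, if z = x then 0 else ENNReal.ofReal (P y z) * avoid P x n z

theorem tsum_eq_add_tsum_ite_zero (f : S → ℝ≥0∞) (x : S) :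
    ∑' z, f z = f x + ∑' z, if z = x then 0 else f z := by
  rw [← tsum_ite_eq x f, ← ENNReal.tsum_add]
  refine tsum_congr fun z => ?_
  split_ifs <;> simp

theorem avoid_add_sum_firstHit {P : S → S → ℝ} (hP : IsStochastic P) (x : S) (n : ℕ) (y : S) :
    avoid P x n y + ∑ j ∈ Finset.range n, firstHit P x j y = 1 := by
  induction n generalizing y with
  | zero => simp [avoid]
  | succ n ih =>
    rw [Finset.sum_range_succ', ← hP.tsum_ofReal y, tsum_eq_add_tsum_ite_zero _ x]
    simp only [avoid, firstHit]
    rw [← add_assoc, add_comm (ENNReal.ofReal (P y x)),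
      ← Summable.tsum_finsetSum (fun _ _ => ENNReal.summable), ← ENNReal.tsum_add]
    congr 1
    refine tsum_congr fun z => ?_
    split_ifs with h
    · simp
    · rw [← Finset.mul_sum, ← mul_add, ih, mul_one]

/-- When the return is certain, avoiding `x` up to time n means hitting it later; this turns
avoidance probabilities into the tails of the hitting time. -/
theorem avoid_eq_tsum {P : S → S → ℝ} (hP : IsStochastic P) {x y : S}
    (h : ∑' n, firstHit P x n y = 1) (n : ℕ) :
    avoid P x n y = ∑' j, firstHit P x (j + n) y := by
  have h1 := avoid_add_sum_firstHit hP x n y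
  rw [← h, ← Summable.sum_add_tsum_nat_add' (k := n) ENNReal.summable, add_comm] at h1
  refine (ENNReal.add_right_inj ?_).1 h1
  refine ne_top_of_le_ne_top ENNReal.one_ne_top ?_
  rw [← avoid_add_sum_firstHit hP x n y]
  exact le_add_self

/-- Kac's lemma: a state charged by a stationary distribution is positive recurrent. -/
theorem IsStationary.positiveRecurrent {P : S → S → ℝ} (hP : IsStochastic P) {v : S → ℝ}
    (hv : IsStationary P v) {x : S} (hx : 0 < v x) : PositiveRecurrent P x := by
  set w : S → ℝ≥0∞ := fun y => ENNReal.ofReal (v y) with hw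
  have hwx0 : w x ≠ 0 := by simpa [hw] using hx
  have hwx : w x ≠ ∞ := ENNReal.ofReal_ne_top
  -- Under the stationary law, avoiding `x` at times 1, …, n splits according to whether time 0 is
  -- at `x`. If it is not, shifting time by one gives avoidance at times 1, …, n + 1.
  have hstep : ∀ n, ∑' y, w y * avoid P x n y
      = w x * avoid P x n x + ∑' y, w y * avoid P x (n + 1) y := by
    intro n
    rw [tsum_eq_add_tsum_ite_zero _ x]
    congr 1
    simp only [avoid, ← ENNReal.tsum_mul_left]
    rw [ENNReal.tsum_comm]
    refine tsum_congr fun z => ?_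
    split_ifs with h
    · simp
    · simp_rw [← mul_assoc, ENNReal.tsum_mul_right]
      rw [hv.tsum_mul hP]
  have hsum : ∀ n, ∑ j ∈ Finset.range n, w x * avoid P x j x + ∑' y, w y * avoid P x n y = 1 := by
    intro n
    induction n with
    | zero => simpa [avoid] using hv.tsum_ofReal
    | succ n ih => rw [Finset.sum_range_succ, add_assoc, ← hstep, ih]
  have hle : ∑' n, w x * avoid P x n x ≤ 1 :=
    ENNReal.tsum_le_of_sum_range_le fun n => by rw [← hsum n]; exact le_self_add
  have hne : ∑' n, avoid P x n x ≠ ∞ := by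
    intro h
    rw [ENNReal.tsum_mul_left, h, ENNReal.mul_top hwx0] at hle
    exact absurd hle (by simp)
  have hlim : Tendsto (fun n => avoid P x n x) atTop (𝓝 0) :=
    ENNReal.tendsto_atTop_zero_of_tsum_ne_top hne
  have hone : ∑' n, firstHit P x n x = 1 := by
    have h1 := hlim.add (ENNReal.tendsto_nat_tsum (fun n => firstHit P x n x))
    simp_rw [avoid_add_sum_firstHit hP x _ x, zero_add] at h1
    exact (tendsto_nhds_unique h1 tendsto_const_nhds)
  refine ⟨hone, ?_⟩
  rw [← tsum_tsum_add]
  simp_rw [← avoid_eq_tsum hP hone]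
  exact hne

/-- The probability that the chain started at `x` is at `y` at time `n` and has not returned
to `x` at the times `1, …, n`. -/
noncomputable def taboo (P : S → S → ℝ) (x : S) : ℕ → S → ℝ≥0∞
  | 0, y => if y = x then 1 else 0
  | n + 1, y => if y = x then 0 else ∑' z, taboo P x n z * ENNReal.ofReal (P z y)

/-- The Markov property at time n: the path has not returned by then and makes its first return j +
1 steps later. -/
theorem tsum_taboo_mul_firstHit (P : S → S → ℝ) (x : S) (n j : ℕ) :
    ∑' z, taboo P x n z * firstHit P x j z = firstHit P x (n + j) x := by
  induction n generalizing j with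
  | zero =>
    rw [tsum_eq_single x (fun z hz => by simp [taboo, hz])]
    simp [taboo]
  | succ n ih =>
    rw [show n + 1 + j = n + (j + 1) by omega, ← ih]
    simp only [firstHit, taboo, ← ENNReal.tsum_mul_left]
    rw [ENNReal.tsum_comm (β := S)]
    refine tsum_congr fun z => ?_
    split_ifs with h
    · simp
    · rw [← ENNReal.tsum_mul_right]
      simp_rw [mul_assoc]

theorem tsum_taboo_mul_avoid (P : S → S → ℝ) (x : S) (n j : ℕ) :
    ∑' z, taboo P x n z * avoid P x j z = avoid P x (n + j) x := by
  induction n generalizing j with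
  | zero =>
    rw [tsum_eq_single x (fun z hz => by simp [taboo, hz])]
    simp [taboo]
  | succ n ih =>
    rw [show n + 1 + j = n + (j + 1) by omega, ← ih]
    simp only [avoid, taboo, ← ENNReal.tsum_mul_left]
    rw [ENNReal.tsum_comm (β := S)]
    refine tsum_congr fun z => ?_
    split_ifs with h
    · simp
    · rw [← ENNReal.tsum_mul_right]
      simp_rw [mul_assoc]

/-- The expected occupation of a cycle at a positive recurrent state is, up to normalisation,
a stationary distribution. -/
theorem PositiveRecurrent.exists_isStationary {P : S → S → ℝ} (hP : IsStochastic P) {x : S}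
    (h : PositiveRecurrent P x) : ∃ v, IsStationary P v ∧ 0 < v x := by
  set W : S → ℝ≥0∞ := fun y => ∑' n, taboo P x n y with hW
  have hmass : ∑' y, W y = ∑' n : ℕ, ((n : ℝ≥0∞) + 1) * firstHit P x n x := by
    rw [← tsum_tsum_add, hW, ENNReal.tsum_comm]
    refine tsum_congr fun n => ?_
    rw [← avoid_eq_tsum hP h.1]
    simpa [avoid] using tsum_taboo_mul_avoid P x n 0
  have hWx : W x = 1 := by
    rw [hW]
    simp only
    rw [tsum_eq_single 0 (fun n hn => by cases n <;> simp_all [taboo])]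
    simp [taboo]
  have hinv : ∀ y, ∑' z, W z * ENNReal.ofReal (P z y) = W y := by
    intro y
    simp_rw [hW, ← ENNReal.tsum_mul_right]
    rw [ENNReal.tsum_comm]
    by_cases hy : y = x
    · subst hy
      -- The flow into the base point sums the probabilities of all first return times, so it is the
      -- return probability 1. Away from the base point, invariance is the shift n ↦ n + 1.
      rw [show ∑' n, taboo P y n y = 1 from hWx, ← h.1]
      exact tsum_congr fun n => tsum_taboo_mul_firstHit P y n 0
    · rw [tsum_eq_zero_add' (f := fun n => taboo P x n y) ENNReal.summable]
      simp [taboo, hy]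
  have hne : ∑' y, W y ≠ 0 := fun h0 => by
    have := ENNReal.tsum_eq_zero.1 h0 x
    simp [hWx] at this
  obtain ⟨v, hv, hpos⟩ := exists_isStationary_of_invariant hP hne (by rw [hmass]; exact h.2) hinv
  exact ⟨v, hv, hpos x (by simp [hWx])⟩

theorem stable_iff_exists_isStationary {P : S → S → ℝ} (hP : IsStochastic P) (x₀ : S) :
    Stable P x₀ ↔ ∃ v, IsStationary P v ∧ 0 < v x₀ := by
  constructor
  · intro h
    exact (h x₀ Relation.ReflTransGen.refl).exists_isStationary hP
  · rintro ⟨v, hv, hpos⟩ y hy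
    exact hv.positiveRecurrent hP (hv.pos_of_reachable hP hpos hy)

end FirstHit

/-- If the chain spends, on average, a positive fraction of time in a finite set, then it has a
stationary distribution charging that set. -/
theorem exists_isStationary_of_le_sum {P : S → S → ℝ} (hP : IsStochastic P) {w : ℕ → S → ℝ≥0∞}
    (hw0 : ∑' x, w 0 x = 1)
    (hw : ∀ n y, w (n + 1) y = ∑' x, w n x * ENNReal.ofReal (P x y))
    {F : Finset S} {δ : ℝ≥0∞} (hδ : δ ≠ 0)
    (hF : ∀ N : ℕ, N * δ ≤ ∑ n ∈ Finset.range N, ∑ y ∈ F, w n y) :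
    ∃ v, IsStationary P v ∧ ∃ y ∈ F, 0 < v y := by
  have hmass : ∀ n, ∑' x, w n x = 1 := by
    intro n
    induction n with
    | zero => exact hw0
    | succ n ih => simp_rw [hw]; rw [hP.tsum_tsum_mul, ih]
  set a : ℕ → S → ℝ≥0∞ :=
    fun N y => ((N : ℝ≥0∞) + 1)⁻¹ * ∑ n ∈ Finset.range (N + 1), w n y with ha
  have hN0 : ∀ N : ℕ, (N : ℝ≥0∞) + 1 ≠ 0 := fun N => by simp
  have hNt : ∀ N : ℕ, (N : ℝ≥0∞) + 1 ≠ ∞ := fun N => by finiteness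
  have hamass : ∀ N, ∑' y, a N y = 1 := by
    intro N
    simp_rw [ha, ENNReal.tsum_mul_left]
    rw [Summable.tsum_finsetSum (fun _ _ => ENNReal.summable)]
    simp only [hmass, Finset.sum_const, Finset.card_range, nsmul_eq_mul, mul_one, Nat.cast_add,
      Nat.cast_one]
    exact ENNReal.inv_mul_cancel (hN0 N) (hNt N)
  -- The Cesàro averages are invariant up to an end term: the two sums differ only by w (N + 1) and
  -- w 0, and w (N + 1) has mass 1.
  have hastep : ∀ N y, ∑' x, a N x * ENNReal.ofReal (P x y) ≤ a N y + ((N : ℝ≥0∞) + 1)⁻¹ := by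
    intro N y
    simp_rw [ha, mul_assoc, ENNReal.tsum_mul_left, Finset.sum_mul]
    rw [Summable.tsum_finsetSum (fun _ _ => ENNReal.summable)]
    simp_rw [← hw]
    have h1 : ∑ n ∈ Finset.range (N + 1), w (n + 1) y
        ≤ ∑ n ∈ Finset.range (N + 1), w n y + 1 := by
      rw [Finset.sum_range_succ, Finset.sum_range_succ' (fun n => w n y), ← hmass (N + 1)]
      gcongr
      · exact le_self_add
      · exact ENNReal.le_tsum y
    calc _ ≤ ((N : ℝ≥0∞) + 1)⁻¹ * (∑ n ∈ Finset.range (N + 1), w n y + 1) := by gcongr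
      _ = _ := by rw [mul_add, mul_one]
  -- A pointwise limit along an ultrafilter exists by Tychonoff. Mass may escape to infinity, so the
  -- limit is at first only subinvariant with mass at most 1; the bound on `F` keeps it nonzero.
  obtain ⟨m, -, hm⟩ := (isCompact_univ (X := S → ℝ≥0∞)).ultrafilter_le_nhds
    ((hyperfilter ℕ).map a) (by simp)
  have hm' : ∀ y, Tendsto (fun N => a N y) (hyperfilter ℕ) (𝓝 (m y)) :=
    fun y => (tendsto_pi_nhds.1 (show Tendsto a (hyperfilter ℕ) (𝓝 m) from hm)) y
  have hinv0 : Tendsto (fun N : ℕ => ((N : ℝ≥0∞) + 1)⁻¹) (hyperfilter ℕ) (𝓝 0) := by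
    have : Tendsto (fun N : ℕ => ((N : ℝ≥0∞) + 1)⁻¹) atTop (𝓝 0) := by
      have := (tendsto_add_atTop_iff_nat 1).2 ENNReal.tendsto_inv_nat_nhds_zero
      simpa using this
    exact this.mono_left (by rw [← Nat.cofinite_eq_atTop]; exact hyperfilter_le_cofinite)
  have hsub : ∀ y, ∑' x, m x * ENNReal.ofReal (P x y) ≤ m y := by
    intro y
    rw [ENNReal.tsum_eq_iSup_sum]
    refine iSup_le fun T => ?_
    have h1 : Tendsto (fun N => ∑ x ∈ T, a N x * ENNReal.ofReal (P x y)) (hyperfilter ℕ)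
        (𝓝 (∑ x ∈ T, m x * ENNReal.ofReal (P x y))) :=
      tendsto_finsetSum _ fun x _ =>
        ENNReal.Tendsto.mul_const (hm' x) (Or.inr ENNReal.ofReal_ne_top)
    have h2 := (hm' y).add hinv0
    rw [add_zero] at h2
    exact le_of_tendsto_of_tendsto' h1 h2 fun N => (ENNReal.sum_le_tsum T).trans (hastep N y)
  have hmle : ∑' x, m x ≤ 1 := by
    rw [ENNReal.tsum_eq_iSup_sum]
    refine iSup_le fun T => ?_
    have h1 : Tendsto (fun N => ∑ x ∈ T, a N x) (hyperfilter ℕ) (𝓝 (∑ x ∈ T, m x)) :=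
      tendsto_finsetSum _ fun x _ => hm' x
    exact le_of_tendsto h1 (Eventually.of_forall fun N =>
      (ENNReal.sum_le_tsum T).trans (hamass N).le)
  have htop : ∑' x, m x ≠ ∞ := ne_top_of_le_ne_top ENNReal.one_ne_top hmle
  have hmF : δ ≤ ∑ y ∈ F, m y := by
    have h1 : Tendsto (fun N => ∑ x ∈ F, a N x) (hyperfilter ℕ) (𝓝 (∑ x ∈ F, m x)) :=
      tendsto_finsetSum _ fun x _ => hm' x
    refine ge_of_tendsto h1 (Eventually.of_forall fun N => ?_)
    simp only [ha]
    rw [← Finset.mul_sum, Finset.sum_comm, mul_comm, ← div_eq_mul_inv,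
      ENNReal.le_div_iff_mul_le (Or.inl (hN0 N)) (Or.inl (hNt N)), mul_comm]
    simpa using hF (N + 1)
  obtain ⟨y, hy, hmy⟩ : ∃ y ∈ F, m y ≠ 0 := by
    by_contra! h
    rw [Finset.sum_eq_zero h] at hmF
    exact hδ (le_zero_iff.1 hmF)
  have h0 : ∑' x, m x ≠ 0 := fun h => hmy (ENNReal.tsum_eq_zero.1 h y)
  obtain ⟨v, hv, hpos⟩ := exists_isStationary_of_invariant hP h0 htop
    (invariant_of_subinvariant hP htop hsub)
  exact ⟨v, hv, y, hy, hpos y hmy⟩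

end ChainTheory

/-! ### One slot -/

theorem bern_nonneg {p : ℝ} (h0 : 0 ≤ p) (h1 : p ≤ 1) (b : Bool) : 0 ≤ bern p b := by
  cases b <;> simp [bern, h0, h1]

theorem Slot.prob_nonneg {l₁ l₂ p₁ p₂ : ℝ} (hl₁ : 0 ≤ l₁) (hl₁' : l₁ ≤ 1) (hl₂ : 0 ≤ l₂)
    (hl₂' : l₂ ≤ 1) (hp₁ : 0 ≤ p₁) (hp₁' : p₁ ≤ 1) (hp₂ : 0 ≤ p₂) (hp₂' : p₂ ≤ 1) (ω : Slot) :
    0 ≤ ω.prob l₁ l₂ p₁ p₂ := by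
  unfold Slot.prob
  have := bern_nonneg hl₁ hl₁' ω.a₁
  have := bern_nonneg hl₂ hl₂' ω.a₂
  have := bern_nonneg hp₁ hp₁' ω.t₁
  have := bern_nonneg hp₂ hp₂' ω.t₂
  positivity

/-- The expectation of a real function of the inputs of one slot. -/
def slotExp (l₁ l₂ p₁ p₂ : ℝ) (f : Slot → ℝ) : ℝ :=
  ∑ a₁ : Bool, ∑ a₂ : Bool, ∑ t₁ : Bool, ∑ t₂ : Bool,
    Slot.prob l₁ l₂ p₁ p₂ ⟨a₁, a₂, t₁, t₂⟩ * f ⟨a₁, a₂, t₁, t₂⟩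

/-- The expectation of an extended nonnegative function of the inputs of one slot. -/
noncomputable def slotLExp (l₁ l₂ p₁ p₂ : ℝ) (f : Slot → ℝ≥0∞) : ℝ≥0∞ :=
  ∑ a₁ : Bool, ∑ a₂ : Bool, ∑ t₁ : Bool, ∑ t₂ : Bool,
    ENNReal.ofReal (Slot.prob l₁ l₂ p₁ p₂ ⟨a₁, a₂, t₁, t₂⟩) * f ⟨a₁, a₂, t₁, t₂⟩

theorem slotProb_nonneg {l₁ l₂ p₁ p₂ : ℝ} (hprob : ∀ ω : Slot, 0 ≤ ω.prob l₁ l₂ p₁ p₂)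
    (E : Slot → Prop) [DecidablePred E] : 0 ≤ slotProb l₁ l₂ p₁ p₂ E := by
  unfold slotProb
  refine Finset.sum_nonneg fun _ _ => Finset.sum_nonneg fun _ _ => Finset.sum_nonneg fun _ _ =>
    Finset.sum_nonneg fun _ _ => ?_
  split_ifs
  exacts [hprob _, le_rfl]

theorem prob_le_slotProb {l₁ l₂ p₁ p₂ : ℝ} (hprob : ∀ ω : Slot, 0 ≤ ω.prob l₁ l₂ p₁ p₂)
    (E : Slot → Prop) [DecidablePred E] (ω : Slot) (h : E ω) :
    ω.prob l₁ l₂ p₁ p₂ ≤ slotProb l₁ l₂ p₁ p₂ E := by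
  obtain ⟨a₁, a₂, t₁, t₂⟩ := ω
  have hn : ∀ a₁ a₂ t₁ t₂, 0 ≤ if E ⟨a₁, a₂, t₁, t₂⟩ then
      Slot.prob l₁ l₂ p₁ p₂ ⟨a₁, a₂, t₁, t₂⟩ else 0 := fun a₁ a₂ t₁ t₂ => by
    split_ifs
    exacts [hprob _, le_rfl]
  unfold slotProb
  calc Slot.prob l₁ l₂ p₁ p₂ ⟨a₁, a₂, t₁, t₂⟩
      = if E ⟨a₁, a₂, t₁, t₂⟩ then Slot.prob l₁ l₂ p₁ p₂ ⟨a₁, a₂, t₁, t₂⟩ else 0 := by simp [h]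
    _ ≤ _ := Finset.single_le_sum (f := fun t₂ => if E ⟨a₁, a₂, t₁, t₂⟩ then
          Slot.prob l₁ l₂ p₁ p₂ ⟨a₁, a₂, t₁, t₂⟩ else 0) (fun _ _ => hn _ _ _ _)
          (Finset.mem_univ t₂)
    _ ≤ _ := Finset.single_le_sum (f := fun t₁ => ∑ t₂, if E ⟨a₁, a₂, t₁, t₂⟩ then
          Slot.prob l₁ l₂ p₁ p₂ ⟨a₁, a₂, t₁, t₂⟩ else 0)
          (fun _ _ => Finset.sum_nonneg fun _ _ => hn _ _ _ _) (Finset.mem_univ t₁)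
    _ ≤ _ := Finset.single_le_sum (f := fun a₂ => ∑ t₁, ∑ t₂, if E ⟨a₁, a₂, t₁, t₂⟩ then
          Slot.prob l₁ l₂ p₁ p₂ ⟨a₁, a₂, t₁, t₂⟩ else 0)
          (fun _ _ => Finset.sum_nonneg fun _ _ => Finset.sum_nonneg fun _ _ => hn _ _ _ _)
          (Finset.mem_univ a₂)
    _ ≤ _ := Finset.single_le_sum (f := fun a₁ => ∑ a₂, ∑ t₁, ∑ t₂, if E ⟨a₁, a₂, t₁, t₂⟩ then
          Slot.prob l₁ l₂ p₁ p₂ ⟨a₁, a₂, t₁, t₂⟩ else 0)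
          (fun _ _ => Finset.sum_nonneg fun _ _ => Finset.sum_nonneg fun _ _ =>
            Finset.sum_nonneg fun _ _ => hn _ _ _ _) (Finset.mem_univ a₁)

/-- The law of the value of a map of the slot inputs. -/
theorem hasSum_slotProb_mul {S : Type*} [DecidableEq S] (l₁ l₂ p₁ p₂ : ℝ) (g : Slot → S)
    (f : S → ℝ) :
    HasSum (fun y => slotProb l₁ l₂ p₁ p₂ (fun ω => g ω = y) * f y)
      (slotExp l₁ l₂ p₁ p₂ (fun ω => f (g ω))) := by
  simp only [slotProb, slotExp, Finset.sum_mul]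
  refine hasSum_sum fun a₁ _ => hasSum_sum fun a₂ _ => hasSum_sum fun t₁ _ =>
    hasSum_sum fun t₂ _ => ?_
  convert hasSum_single (g ⟨a₁, a₂, t₁, t₂⟩) (fun y hy => ?_) using 1
  · simp
  · simp [Ne.symm hy]

theorem tsum_ofReal_slotProb_mul {S : Type*} [DecidableEq S] {l₁ l₂ p₁ p₂ : ℝ}
    (hprob : ∀ ω : Slot, 0 ≤ ω.prob l₁ l₂ p₁ p₂) (g : Slot → S) (f : S → ℝ≥0∞) :
    ∑' y, ENNReal.ofReal (slotProb l₁ l₂ p₁ p₂ (fun ω => g ω = y)) * f y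
      = slotLExp l₁ l₂ p₁ p₂ (fun ω => f (g ω)) := by
  have hn : ∀ y a₁ a₂ t₁ t₂, 0 ≤ if g ⟨a₁, a₂, t₁, t₂⟩ = y then
      Slot.prob l₁ l₂ p₁ p₂ ⟨a₁, a₂, t₁, t₂⟩ else 0 := fun y a₁ a₂ t₁ t₂ => by
    split_ifs
    exacts [hprob _, le_rfl]
  have key : ∀ y, ENNReal.ofReal (slotProb l₁ l₂ p₁ p₂ (fun ω => g ω = y)) * f y
      = ∑ a₁ : Bool, ∑ a₂ : Bool, ∑ t₁ : Bool, ∑ t₂ : Bool, if y = g ⟨a₁, a₂, t₁, t₂⟩ then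
        ENNReal.ofReal (Slot.prob l₁ l₂ p₁ p₂ ⟨a₁, a₂, t₁, t₂⟩) * f y else 0 := by
    intro y
    unfold slotProb
    rw [ENNReal.ofReal_sum_of_nonneg (fun _ _ => Finset.sum_nonneg fun _ _ =>
      Finset.sum_nonneg fun _ _ => Finset.sum_nonneg fun _ _ => hn _ _ _ _ _), Finset.sum_mul]
    refine Finset.sum_congr rfl fun a₁ _ => ?_
    rw [ENNReal.ofReal_sum_of_nonneg (fun _ _ =>
      Finset.sum_nonneg fun _ _ => Finset.sum_nonneg fun _ _ => hn _ _ _ _ _), Finset.sum_mul]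
    refine Finset.sum_congr rfl fun a₂ _ => ?_
    rw [ENNReal.ofReal_sum_of_nonneg (fun _ _ =>
      Finset.sum_nonneg fun _ _ => hn _ _ _ _ _), Finset.sum_mul]
    refine Finset.sum_congr rfl fun t₁ _ => ?_
    rw [ENNReal.ofReal_sum_of_nonneg (fun _ _ => hn _ _ _ _ _), Finset.sum_mul]
    refine Finset.sum_congr rfl fun t₂ _ => ?_
    by_cases h : y = g ⟨a₁, a₂, t₁, t₂⟩
    · simp [h]
    · simp [h, Ne.symm h]
  simp_rw [key, slotLExp]
  rw [Summable.tsum_finsetSum (fun _ _ => ENNReal.summable)]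
  refine Finset.sum_congr rfl fun a₁ _ => ?_
  rw [Summable.tsum_finsetSum (fun _ _ => ENNReal.summable)]
  refine Finset.sum_congr rfl fun a₂ _ => ?_
  rw [Summable.tsum_finsetSum (fun _ _ => ENNReal.summable)]
  refine Finset.sum_congr rfl fun t₁ _ => ?_
  rw [Summable.tsum_finsetSum (fun _ _ => ENNReal.summable)]
  refine Finset.sum_congr rfl fun t₂ _ => ?_
  rw [tsum_eq_single (g ⟨a₁, a₂, t₁, t₂⟩) (fun y hy => by simp [hy])]
  simp

theorem slotLExp_ofReal {l₁ l₂ p₁ p₂ : ℝ} (hprob : ∀ ω : Slot, 0 ≤ ω.prob l₁ l₂ p₁ p₂)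
    {f : Slot → ℝ} (hf : ∀ ω, 0 ≤ f ω) :
    slotLExp l₁ l₂ p₁ p₂ (fun ω => ENNReal.ofReal (f ω))
      = ENNReal.ofReal (slotExp l₁ l₂ p₁ p₂ f) := by
  have hn : ∀ a₁ a₂ t₁ t₂, 0 ≤ Slot.prob l₁ l₂ p₁ p₂ ⟨a₁, a₂, t₁, t₂⟩ * f ⟨a₁, a₂, t₁, t₂⟩ :=
    fun _ _ _ _ => mul_nonneg (hprob _) (hf _)
  unfold slotLExp slotExp
  rw [ENNReal.ofReal_sum_of_nonneg (fun _ _ => Finset.sum_nonneg fun _ _ =>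
    Finset.sum_nonneg fun _ _ => Finset.sum_nonneg fun _ _ => hn _ _ _ _)]
  refine Finset.sum_congr rfl fun a₁ _ => ?_
  rw [ENNReal.ofReal_sum_of_nonneg (fun _ _ =>
    Finset.sum_nonneg fun _ _ => Finset.sum_nonneg fun _ _ => hn _ _ _ _)]
  refine Finset.sum_congr rfl fun a₂ _ => ?_
  rw [ENNReal.ofReal_sum_of_nonneg (fun _ _ => Finset.sum_nonneg fun _ _ => hn _ _ _ _)]
  refine Finset.sum_congr rfl fun t₁ _ => ?_
  rw [ENNReal.ofReal_sum_of_nonneg (fun _ _ => hn _ _ _ _)]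
  refine Finset.sum_congr rfl fun t₂ _ => ?_
  rw [ENNReal.ofReal_mul (hprob _)]

theorem slotExp_one (l₁ l₂ p₁ p₂ : ℝ) : slotExp l₁ l₂ p₁ p₂ (fun _ => 1) = 1 := by
  simp [slotExp, Slot.prob, bern]
  ring

theorem slotProb_eq_sum_of_forall_iff (l₁ l₂ p₁ p₂ : ℝ) (E : Slot → Prop) [DecidablePred E]
    (hE : ∀ a₁ a₂ t₁ t₂, E ⟨a₁, a₂, t₁, t₂⟩ ↔ E ⟨false, a₂, t₁, t₂⟩) :
    slotProb l₁ l₂ p₁ p₂ E = ∑ a₂ : Bool, ∑ t₁ : Bool, ∑ t₂ : Bool,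
      if E ⟨false, a₂, t₁, t₂⟩ then bern l₂ a₂ * bern p₁ t₁ * bern p₂ t₂ else 0 := by
  have h : ∀ a₁ a₂ t₁ t₂, (if E ⟨a₁, a₂, t₁, t₂⟩ then Slot.prob l₁ l₂ p₁ p₂ ⟨a₁, a₂, t₁, t₂⟩ else 0)
      = bern l₁ a₁ *
        if E ⟨false, a₂, t₁, t₂⟩ then bern l₂ a₂ * bern p₁ t₁ * bern p₂ t₂ else 0 := by
    intro a₁ a₂ t₁ t₂
    by_cases hc : E ⟨false, a₂, t₁, t₂⟩
    · rw [if_pos ((hE a₁ a₂ t₁ t₂).2 hc), if_pos hc, Slot.prob]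
      ring
    · rw [if_neg (mt (hE a₁ a₂ t₁ t₂).1 hc), if_neg hc, mul_zero]
  simp_rw [slotProb, h, ← Finset.mul_sum, ← Finset.sum_mul]
  rw [show ∑ b : Bool, bern l₁ b = 1 by simp [bern], one_mul]

/-- The probability of an event that ignores the arrivals at queue 1 does not depend on their
rate. -/
theorem slotProb_congr_rate (l₁ l₁' l₂ p₁ p₂ : ℝ) (E : Slot → Prop) [DecidablePred E]
    (hE : ∀ a₁ a₂ t₁ t₂, E ⟨a₁, a₂, t₁, t₂⟩ ↔ E ⟨false, a₂, t₁, t₂⟩) :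
    slotProb l₁ l₂ p₁ p₂ E = slotProb l₁' l₂ p₁ p₂ E := by
  rw [slotProb_eq_sum_of_forall_iff _ _ _ _ _ hE, slotProb_eq_sum_of_forall_iff _ _ _ _ _ hE]

theorem hasSum_sysTrans_fst (l₁ l₂ p₁ p₂ : ℝ) (q : ℕ) (z z' : State₂) :
    HasSum (fun q' : ℕ => sysTrans l₁ l₂ p₁ p₂ (q, z) (q', z')) (trans₂ l₂ p₁ p₂ z z') := by
  have h : trans₂ l₂ p₁ p₂ z z' = slotProb l₁ l₂ p₁ p₂ (fun ω => next₂ z ω = z') :=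
    slotProb_congr_rate _ _ _ _ _ _ fun _ _ _ _ => Iff.rfl
  rw [h]
  unfold sysTrans slotProb
  refine hasSum_sum fun a₁ _ => hasSum_sum fun a₂ _ => hasSum_sum fun t₁ _ =>
    hasSum_sum fun t₂ _ => ?_
  convert hasSum_single (next (q, z) ⟨a₁, a₂, t₁, t₂⟩).1 (fun q' hq' => ?_) using 1
  · simp [next, Prod.ext_iff]
  · rw [if_neg]
    intro h
    exact hq' (by rw [h])

theorem isHomogeneousQBD_trans₂ (l₂ p₁ p₂ : ℝ) :
    IsHomogeneousQBD (trans₂ l₂ p₁ p₂)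
      (blockB l₂ p₁ p₂) (blockA₀ l₂ p₁ p₂) (blockA₁ l₂ p₁ p₂) (blockA₂ l₂ p₁ p₂) := by
  intro i j
  refine ⟨?_, fun k => ?_, fun k => ?_, fun k => ?_, fun k m h => ?_⟩
  · fin_cases i <;> fin_cases j <;>
      simp [trans₂, slotProb, next₂, served₂, tx₁, tx₂, Slot.prob, bern, blockB] <;> ring
  · have hk : k + 1 + 1 ≠ k := by omega
    fin_cases i <;> fin_cases j <;>
      simp [trans₂, slotProb, next₂, served₂, tx₁, tx₂, Slot.prob, bern, blockA₀, hk]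
  · fin_cases i <;> fin_cases j <;>
      simp [trans₂, slotProb, next₂, served₂, tx₁, tx₂, Slot.prob, bern, blockA₁] <;> ring
  · have hk : ∀ m, k - m ≠ k + 1 := by omega
    fin_cases i <;> fin_cases j <;>
      simp [trans₂, slotProb, next₂, served₂, tx₁, tx₂, Slot.prob, bern, blockA₂, hk] <;> ring
  · have hne : ∀ ω, next₂ (k, j) ω ≠ (m, i) := by
      intro ω hω
      have h1 : k + ω.a₂.toNat - (served₂ (k, j) ω).toNat = m := congrArg Prod.fst hω
      have h2 := Bool.toNat_le ω.a₂
      have h3 := Bool.toNat_le (served₂ (k, j) ω)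
      omega
    simp [trans₂, slotProb, hne]

/-! ### The stationary distribution of queue 2 -/

theorem hasSum_prod_fin_two {f : State₂ → ℝ} {a b : ℝ} (ha : HasSum (fun k => f (k, 0)) a)
    (hb : HasSum (fun k => f (k, 1)) b) : HasSum f (a + b) := by
  have inj : ∀ j : Fin 2, Function.Injective (fun k : ℕ => ((k, j) : State₂)) :=
    fun j k k' h => congrArg Prod.fst h
  have h0 : HasSum (fun z : State₂ => if z.2 = 0 then f z else 0) a := by
    refine ((inj 0).hasSum_iff fun z hz => ?_).1 (by simpa [Function.comp_def] using ha)
    obtain ⟨k, j⟩ := z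
    rw [if_neg]
    rintro rfl
    exact hz ⟨k, rfl⟩
  have h1 : HasSum (fun z : State₂ => if z.2 = 1 then f z else 0) b := by
    refine ((inj 1).hasSum_iff fun z hz => ?_).1 (by simpa [Function.comp_def] using hb)
    obtain ⟨k, j⟩ := z
    rw [if_neg]
    rintro rfl
    exact hz ⟨k, rfl⟩
  convert h0.add h1 using 2 with z
  obtain ⟨k, j⟩ := z
  fin_cases j <;> simp

theorem exists_hasSum_of_hasSum_prod_fin_two {f : State₂ → ℝ} {c : ℝ} (h : HasSum f c) :
    ∃ a b, HasSum (fun k => f (k, 0)) a ∧ HasSum (fun k => f (k, 1)) b ∧ a + b = c := by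
  have inj : ∀ j : Fin 2, Function.Injective (fun k : ℕ => ((k, j) : State₂)) :=
    fun j k k' h => congrArg Prod.fst h
  have h0 := (h.summable.comp_injective (inj 0)).hasSum
  have h1 := (h.summable.comp_injective (inj 1)).hasSum
  exact ⟨_, _, h0, h1, (hasSum_prod_fin_two h0 h1).unique h⟩

theorem IsHomogeneousQBD.hasSum_zero {P : State₂ → State₂ → ℝ}
    {B A₀ A₁ A₂ : Matrix (Fin 2) (Fin 2) ℝ} (h : IsHomogeneousQBD P B A₀ A₁ A₂)
    (v : State₂ → ℝ) (i : Fin 2) :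
    HasSum (fun z => v z * P z (0, i))
      ((v (0, 0) * B i 0 + v (1, 0) * A₀ i 0) + (v (0, 1) * B i 1 + v (1, 1) * A₀ i 1)) := by
  have key : ∀ j : Fin 2, HasSum (fun k : ℕ => v (k, j) * P (k, j) (0, i))
      (v (0, j) * B i j + v (1, j) * A₀ i j) := by
    intro j
    obtain ⟨hB, h0, -, -, hz⟩ := h i j
    convert hasSum_sum_of_ne_finset_zero (s := Finset.range 2)
      (f := fun k : ℕ => v (k, j) * P (k, j) (0, i)) (fun k hk => ?_) using 1
    · have := h0 0
      rw [zero_add] at this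
      simp [Finset.sum_range_succ, hB, this]
    · rw [hz k 0 (by simp at hk; omega), mul_zero]
    · infer_instance
  exact hasSum_prod_fin_two (key 0) (key 1)

theorem IsHomogeneousQBD.hasSum_succ {P : State₂ → State₂ → ℝ}
    {B A₀ A₁ A₂ : Matrix (Fin 2) (Fin 2) ℝ} (h : IsHomogeneousQBD P B A₀ A₁ A₂)
    (v : State₂ → ℝ) (m : ℕ) (i : Fin 2) :
    HasSum (fun z => v z * P z (m + 1, i))
      ((v (m, 0) * A₂ i 0 + v (m + 1, 0) * A₁ i 0 + v (m + 2, 0) * A₀ i 0) +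
        (v (m, 1) * A₂ i 1 + v (m + 1, 1) * A₁ i 1 + v (m + 2, 1) * A₀ i 1)) := by
  have key : ∀ j : Fin 2, HasSum (fun k : ℕ => v (k, j) * P (k, j) (m + 1, i))
      (v (m, j) * A₂ i j + v (m + 1, j) * A₁ i j + v (m + 2, j) * A₀ i j) := by
    intro j
    obtain ⟨-, h0, h1, h2, hz⟩ := h i j
    convert hasSum_sum_of_ne_finset_zero (s := {m, m + 1, m + 2})
      (f := fun k : ℕ => v (k, j) * P (k, j) (m + 1, i)) (fun k hk => ?_) using 1
    · have := h0 (m + 1)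
      rw [add_assoc] at this
      simp [Finset.sum_insert, h1, h2, this, add_assoc]
    · rw [hz k (m + 1) (by simp at hk; omega), mul_zero]
    · infer_instance
  exact hasSum_prod_fin_two (key 0) (key 1)

/-- The balance equations of queue 2, in cut form: the flow between two adjacent levels, and
the flow into an OFF state. -/
theorem isStationary_trans₂_recurrence {l₂ p₁ p₂ : ℝ} {v : State₂ → ℝ}
    (hv : IsStationary (trans₂ l₂ p₁ p₂) v) :
    v (0, 1) = 0 ∧ ∀ k,
      (1 - l₂) * (1 - p₁) * p₂ * v (k + 1, 0)
        = l₂ * (1 - p₂ + p₁ * p₂) * v (k, 0) + l₂ * v (k, 1) ∧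
      v (k + 1, 1) = p₁ * p₂ * l₂ * v (k, 0) + p₁ * p₂ * (1 - l₂) * v (k + 1, 0) := by
  have hQ := isHomogeneousQBD_trans₂ l₂ p₁ p₂
  have b00 := (hQ.hasSum_zero v 0).unique (hv.2.2 (0, 0))
  have b01 := (hQ.hasSum_zero v 1).unique (hv.2.2 (0, 1))
  have b10 := fun k => (hQ.hasSum_succ v k 0).unique (hv.2.2 (k + 1, 0))
  have b11 := fun k => (hQ.hasSum_succ v k 1).unique (hv.2.2 (k + 1, 1))
  simp [blockB, blockA₀, blockA₁, blockA₂] at b00 b01 b10 b11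
  have hoff : ∀ k, v (k + 1, 1)
      = p₁ * p₂ * l₂ * v (k, 0) + p₁ * p₂ * (1 - l₂) * v (k + 1, 0) := by
    intro k
    linear_combination -b11 k
  refine ⟨b01.symm, fun k => ⟨?_, hoff k⟩⟩
  -- The cut equation at level 0 is the balance at (0, ON). Each next one adds the balance at (k +
  -- 1, ON) to the previous cut and removes the flow through the OFF state.
  induction k with
  | zero =>
    rw [← b01] at b00 ⊢
    linear_combination b00
  | succ k ih =>
    linear_combination b10 k + ih - hoff k

/-- One application of R is one step of the cut equations; the bottom row of R comes from
substituting the first equation into the second. -/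
theorem rateR_mulVec_iff {l₂ p₁ p₂ : ℝ} (hl₂' : l₂ < 1) (hp₁' : p₁ < 1) (hp₂ : 0 < p₂)
    (x y x' y' : ℝ) :
    ![x', y'] = (rateR l₂ p₁ p₂).mulVec ![x, y] ↔
      (1 - l₂) * (1 - p₁) * p₂ * x' = l₂ * (1 - p₂ + p₁ * p₂) * x + l₂ * y ∧
      y' = p₁ * p₂ * l₂ * x + p₁ * p₂ * (1 - l₂) * x' := by
  have h1 : (1 - l₂) ≠ 0 := by linarith
  have h2 : (1 - p₁) ≠ 0 := by linarith
  have h3 := hp₂.ne'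
  have e0 : x' = l₂ * (1 - p₂ + p₁ * p₂) / ((1 - l₂) * (1 - p₁) * p₂) * x
      + l₂ / ((1 - l₂) * (1 - p₁) * p₂) * y ↔
      (1 - l₂) * (1 - p₁) * p₂ * x' = l₂ * (1 - p₂ + p₁ * p₂) * x + l₂ * y := by
    rw [div_mul_eq_mul_div, div_mul_eq_mul_div, ← add_div, eq_div_iff (by positivity), mul_comm]
  have e : ![x', y'] = (rateR l₂ p₁ p₂).mulVec ![x, y] ↔
      x' = l₂ * (1 - p₂ + p₁ * p₂) / ((1 - l₂) * (1 - p₁) * p₂) * x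
        + l₂ / ((1 - l₂) * (1 - p₁) * p₂) * y ∧
      y' = l₂ * p₁ / (1 - p₁) * x + l₂ * p₁ / (1 - p₁) * y := by
    rw [funext_iff, Fin.forall_fin_two]
    simp [rateR, Matrix.mulVec, dotProduct, Fin.sum_univ_two]
  rw [e, e0]
  refine and_congr_right fun h => ?_
  have : l₂ * p₁ / (1 - p₁) * x + l₂ * p₁ / (1 - p₁) * y
      = p₁ * p₂ * l₂ * x + p₁ * p₂ * (1 - l₂) * x' := by
    field_simp
    linear_combination -p₁ * h
  rw [this]

theorem isStationary_trans₂_eq_rateR_pow {l₂ p₁ p₂ : ℝ} (hl₂' : l₂ < 1) (hp₁' : p₁ < 1)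
    (hp₂ : 0 < p₂) {v : State₂ → ℝ} (hv : IsStationary (trans₂ l₂ p₁ p₂) v) (k : ℕ) :
    (fun i : Fin 2 => v (k, i)) = (rateR l₂ p₁ p₂ ^ k).mulVec (fun i : Fin 2 => v (0, i)) := by
  induction k with
  | zero => simp
  | succ k ih =>
    rw [pow_succ', ← Matrix.mulVec_mulVec, ← ih]
    have h2 : ∀ m, (fun i : Fin 2 => v (m, i)) = ![v (m, 0), v (m, 1)] := by
      intro m
      ext i
      fin_cases i <;> rfl
    rw [h2, h2, rateR_mulVec_iff hl₂' hp₁' hp₂]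
    exact (isStationary_trans₂_recurrence hv).2 k

theorem serviceProb₁_zero (l₂ p₁ p₂ : ℝ) :
    serviceProb₁ l₂ p₁ p₂ (0, 0) = p₁ * (1 - p₂) + p₁ * p₂ * (1 - l₂) := by
  simp [serviceProb₁, slotProb, served₁, tx₁, tx₂, Slot.prob, bern]
  ring

theorem serviceProb₁_succ (l₂ p₁ p₂ : ℝ) (k : ℕ) :
    serviceProb₁ l₂ p₁ p₂ (k + 1, 0) = p₁ * (1 - p₂) := by
  simp [serviceProb₁, slotProb, served₁, tx₁, tx₂, Slot.prob, bern]
  ring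

theorem serviceProb₁_off (l₂ p₁ p₂ : ℝ) (k : ℕ) : serviceProb₁ l₂ p₁ p₂ (k, 1) = 1 := by
  simp [serviceProb₁, slotProb, served₁, tx₁, tx₂, Slot.prob, bern]
  ring

/-- The consequences of the balance equations of queue 2 and of normalisation. -/
theorem IsStationary.trans₂_sums {l₂ p₁ p₂ : ℝ} {v : State₂ → ℝ}
    (hv : IsStationary (trans₂ l₂ p₁ p₂) v) :
    (1 - l₂) * (1 - p₁) * p₂ * v (0, 0) = p₂ - l₂ - p₁ * p₂ - l₂ * p₁ * p₂ ∧
    ∃ X, (1 + p₁ * p₂) * X = 1 + p₁ * p₂ * (1 - l₂) * v (0, 0) ∧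
      HasSum (fun z => v z * serviceProb₁ l₂ p₁ p₂ z) (p₁ * X) := by
  obtain ⟨h0, hrec⟩ := isStationary_trans₂_recurrence hv
  obtain ⟨X, Y, hX, hY, hXY⟩ := exists_hasSum_of_hasSum_prod_fin_two hv.2.1
  have hX' : HasSum (fun k => v (k + 1, 0)) (X - v (0, 0)) := by
    have := (hasSum_nat_add_iff' (f := fun k => v (k, 0)) 1).2 hX
    simpa using this
  have hY' : HasSum (fun k => v (k + 1, 1)) Y := by
    have := (hasSum_nat_add_iff' (f := fun k => v (k, 1)) 1).2 hY
    simpa [h0] using this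
  -- Summing both cut equations over all levels leaves a linear system for the ON mass X, the OFF
  -- mass Y and v(0, ON), closed by X + Y = 1.
  have e1 := (hX'.mul_left ((1 - l₂) * (1 - p₁) * p₂)).unique
    (((hX.mul_left (l₂ * (1 - p₂ + p₁ * p₂))).add (hY.mul_left l₂)).congr_fun
      fun k => (hrec k).1)
  have e2 := hY'.unique (((hX.mul_left (p₁ * p₂ * l₂)).add
    (hX'.mul_left (p₁ * p₂ * (1 - l₂)))).congr_fun fun k => (hrec k).2)
  have e3 : Y = 1 - X := by linarith
  subst e3
  refine ⟨?_, X, by linear_combination -e2, ?_⟩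
  · linear_combination (-1 - p₁ * p₂) * e1 - (p₂ - p₁ * p₂) * e2
  · have hs0 : HasSum (fun k => v (k, 0) * serviceProb₁ l₂ p₁ p₂ (k, 0))
        (p₁ * (1 - p₂) * X + p₁ * p₂ * (1 - l₂) * v (0, 0)) := by
      refine ((hX.mul_left (p₁ * (1 - p₂))).add
        (hasSum_single 0 (f := fun k : ℕ => if k = 0 then p₁ * p₂ * (1 - l₂) * v (0, 0) else 0)
          fun k hk => if_neg hk)).congr_fun fun k => ?_
      cases k with
      | zero => rw [serviceProb₁_zero, if_pos rfl]; ring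
      | succ k => rw [serviceProb₁_succ, if_neg (Nat.succ_ne_zero k)]; ring
    have hs1 : HasSum (fun k => v (k, 1) * serviceProb₁ l₂ p₁ p₂ (k, 1)) (1 - X) :=
      hY.congr_fun fun k => by rw [serviceProb₁_off, mul_one]
    have hs := hasSum_prod_fin_two (f := fun z => v z * serviceProb₁ l₂ p₁ p₂ z) hs0 hs1
    -- Queue 1 attempts at rate p₁X in ON slots and loses the collisions. Collisions are as frequent
    -- as OFF slots, in each of which it succeeds, so losses and gains cancel.
    rwa [show p₁ * (1 - p₂) * X + p₁ * p₂ * (1 - l₂) * v (0, 0) + (1 - X) = p₁ * X by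
      linear_combination e2] at hs

theorem IsStationary.trans₂_critical {l₂ p₁ p₂ : ℝ} (hl₂ : 0 < l₂) (hl₂' : l₂ < 1)
    (hp₁' : p₁ < 1) (hp₂ : 0 ≤ p₂)
    {v : State₂ → ℝ} (hv : IsStationary (trans₂ l₂ p₁ p₂) v) :
    0 < p₂ ∧ 0 < p₂ - l₂ - p₁ * p₂ - l₂ * p₁ * p₂ ∧ 0 < v (0, 0) := by
  have h1 : 0 < 1 - l₂ := by linarith
  have h2 : 0 < 1 - p₁ := by linarith
  have hd := hv.trans₂_sums.1
  have hp₂' : 0 < p₂ := by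
    refine lt_of_le_of_ne hp₂ fun h => ?_
    subst h
    linarith
  have h0 : 0 < v (0, 0) := by
    refine lt_of_le_of_ne (hv.1 _) fun h => ?_
    have hz : ∀ z, v z = 0 := by
      rintro ⟨k, i⟩
      have h3 := congrFun (isStationary_trans₂_eq_rateR_pow hl₂' hp₁' hp₂' hv k) i
      have h4 : (fun i : Fin 2 => v (0, i)) = 0 := by
        ext i
        fin_cases i
        exacts [h.symm, (isStationary_trans₂_recurrence hv).1]
      simpa [h4] using h3
    -- If v(0, ON) vanished, the recursion would make v vanish identically, against total mass 1.
    have h5 : HasSum v 0 := by simp [funext hz]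
    exact zero_ne_one (h5.unique hv.2.1)
  exact ⟨hp₂', hd ▸ by positivity, h0⟩

theorem IsStationary.hasSum_serviceProb₁ {l₂ p₁ p₂ : ℝ} (hl₂ : 0 < l₂) (hl₂' : l₂ < 1)
    (hp₁ : 0 ≤ p₁) (hp₁' : p₁ < 1) (hp₂ : 0 ≤ p₂)
    {v : State₂ → ℝ} (hv : IsStationary (trans₂ l₂ p₁ p₂) v) :
    HasSum (fun z => v z * serviceProb₁ l₂ p₁ p₂ z) (p₁ * (1 - p₁ - l₂ * p₁) / (1 - p₁)) := by
  obtain ⟨hd, X, hX, hs⟩ := hv.trans₂_sums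
  obtain ⟨hp₂', -, -⟩ := hv.trans₂_critical hl₂ hl₂' hp₁' hp₂
  have h2 : 0 < 1 - p₁ := by linarith
  have hc : (1 + p₁ * p₂) ≠ 0 := by positivity
  have : X = (1 - p₁ - l₂ * p₁) / (1 - p₁) := by
    rw [eq_div_iff h2.ne']
    refine mul_left_cancel₀ hc ?_
    linear_combination (1 - p₁) * hX + p₁ * hd
  rwa [this, ← mul_div_assoc] at hs

theorem exists_isStationary_trans₂ {l₂ p₁ p₂ : ℝ} (hl₂ : 0 < l₂) (hl₂' : l₂ < 1)
    (hp₁ : 0 ≤ p₁) (hp₁' : p₁ < 1) (hp₂ : 0 < p₂) (hp₂' : p₂ ≤ 1)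
    (hκ : 0 < p₂ - l₂ - p₁ * p₂ - l₂ * p₁ * p₂) :
    ∃ v, IsStationary (trans₂ l₂ p₁ p₂) v := by
  have h1 : 0 < 1 - l₂ := by linarith
  have h2 : 0 < 1 - p₁ := by linarith
  have hc : 0 ≤ p₁ * p₂ := by positivity
  have hcp : 0 ≤ p₂ - p₁ * p₂ := by nlinarith
  have hs : 0 ≤ 1 - p₂ + p₁ * p₂ := by linarith
  have hd : 0 < (1 - l₂) * (1 - p₁) * p₂ := by positivity
  set κ := p₂ - l₂ - p₁ * p₂ - l₂ * p₁ * p₂ with hκ'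
  set d := (1 - l₂) * (1 - p₁) * p₂ with hd'
  set u : ℕ → Fin 2 → ℝ := fun k => (rateR l₂ p₁ p₂ ^ k).mulVec ![κ / d, 0] with hu
  have hrec : ∀ k, d * u (k + 1) 0 = l₂ * (1 - p₂ + p₁ * p₂) * u k 0 + l₂ * u k 1 ∧
      u (k + 1) 1 = p₁ * p₂ * l₂ * u k 0 + p₁ * p₂ * (1 - l₂) * u (k + 1) 0 := by
    intro k
    rw [hd', ← rateR_mulVec_iff hl₂' hp₁' hp₂]
    have h3 : ∀ m, ![u m 0, u m 1] = u m := by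
      intro m
      ext i
      fin_cases i <;> rfl
    rw [h3, h3, hu]
    simp only
    rw [pow_succ', ← Matrix.mulVec_mulVec]
  have hu0 : u 0 0 = κ / d := by simp [hu]
  have hu1 : u 0 1 = 0 := by simp [hu]
  have hnn : ∀ k, 0 ≤ u k 0 ∧ 0 ≤ u k 1 := by
    intro k
    induction k with
    | zero =>
      rw [hu0, hu1]
      exact ⟨by positivity, le_rfl⟩
    | succ k ih =>
      obtain ⟨i0, i1⟩ := ih
      obtain ⟨r0, r1⟩ := hrec k
      have h0 : 0 ≤ u (k + 1) 0 := by
        refine nonneg_of_mul_nonneg_right (a := d) ?_ hd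
        rw [r0]
        positivity
      exact ⟨h0, by rw [r1]; positivity⟩
  -- The weights d and p₂ - p₁p₂ form a row vector y with y(I - R) = κ(1, 1), so κ times the mass of
  -- a level is a difference of consecutive values of y·u. This gives summability and the total mass
  -- without any spectral estimate.
  have htel : ∀ n, ∑ k ∈ Finset.range n, κ * (u k 0 + u k 1)
      = κ - (d * u n 0 + (p₂ - p₁ * p₂) * u n 1) := by
    intro n
    induction n with
    | zero =>
      rw [hu0, hu1]
      field_simp
      simp
    | succ n ih =>
      obtain ⟨r0, r1⟩ := hrec n
      rw [Finset.sum_range_succ, ih, r1, hκ']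
      have h5 : u (n + 1) 0 * (d + (p₂ - p₁ * p₂) * (p₁ * p₂ * (1 - l₂))) =
        (1 + p₁ * p₂) * (d * u (n + 1) 0) := by rw [hd']; ring
      linear_combination h5 + (1 + p₁ * p₂) * r0
  have hsum : Summable (fun k => u k 0 + u k 1) := by
    refine summable_of_sum_range_le (c := 1)
      (fun k => add_nonneg (hnn k).1 (hnn k).2) fun n => ?_
    have h3 := htel n
    rw [← Finset.mul_sum] at h3
    have h4 : 0 ≤ d * u n 0 + (p₂ - p₁ * p₂) * u n 1 :=
      add_nonneg (mul_nonneg hd.le (hnn n).1) (mul_nonneg hcp (hnn n).2)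
    refine le_of_mul_le_mul_left ?_ hκ
    linarith
  have hs0 : Summable (fun k => u k 0) :=
    hsum.of_nonneg_of_le (fun k => (hnn k).1) fun k => by linarith [(hnn k).2]
  have hs1 : Summable (fun k => u k 1) :=
    hsum.of_nonneg_of_le (fun k => (hnn k).2) fun k => by linarith [(hnn k).1]
  have htot : HasSum (fun k => u k 0 + u k 1) 1 := by
    have h3 := (hsum.hasSum.mul_left κ).tendsto_sum_nat
    simp_rw [htel] at h3
    have h4 := tendsto_const_nhds (x := κ) |>.sub
      ((hs0.tendsto_atTop_zero.const_mul d).add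
        (hs1.tendsto_atTop_zero.const_mul (p₂ - p₁ * p₂)))
    have h5 := tendsto_nhds_unique h3 h4
    have h6 : ∑' k, (u k 0 + u k 1) = 1 := by
      refine mul_left_cancel₀ hκ.ne' ?_
      rw [h5]
      ring
    exact h6 ▸ hsum.hasSum
  have hQ := isHomogeneousQBD_trans₂ l₂ p₁ p₂
  refine ⟨fun z => u z.1 z.2, ?_, ?_, ?_⟩
  · rintro ⟨k, i⟩
    fin_cases i
    exacts [(hnn k).1, (hnn k).2]
  · have h3 := hasSum_prod_fin_two (f := fun z => u z.1 z.2) hs0.hasSum hs1.hasSum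
    rwa [(hs0.hasSum.add hs1.hasSum).unique htot] at h3
  · have hstep : ∀ k, d * u (k + 1) 0 = l₂ * (1 - p₂ + p₁ * p₂) * u k 0 + l₂ * u k 1 :=
      fun k => (hrec k).1
    have hoff : ∀ k, u (k + 1) 1 = p₁ * p₂ * l₂ * u k 0 + p₁ * p₂ * (1 - l₂) * u (k + 1) 0 :=
      fun k => (hrec k).2
    rw [hd'] at hstep
    rintro ⟨_ | k, i⟩
    · convert hQ.hasSum_zero (fun z => u z.1 z.2) i using 1
      fin_cases i
      · simp [blockB, blockA₀]
        have := hstep 0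
        rw [hu1] at this ⊢
        rw [zero_add] at this
        linear_combination -this
      · simp [blockB, blockA₀, hu1]
    · convert hQ.hasSum_succ (fun z => u z.1 z.2) k i using 1
      fin_cases i
      · simp [blockA₀, blockA₁, blockA₂]
        linear_combination hstep k - hstep (k + 1) - hoff k
      · simp [blockA₀, blockA₁, blockA₂]
        linear_combination hoff k

/-! ### The rate matrix -/

theorem sp_eq_of_trace_det {M : Matrix (Fin 2) (Fin 2) ℝ} {r s : ℝ} (htr : M.trace = r + s)
    (hdet : M.det = r * s) (hrs : |s| ≤ r) : sp M = ENNReal.ofReal r := by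
  have hmem : ∀ z : ℂ, z ∈ spectrum ℂ (M.map (fun x : ℝ => (x : ℂ))) ↔ z = r ∨ z = s := by
    intro z
    have htr' : ((M 0 0 : ℝ) : ℂ) + (M 1 1 : ℝ) = r + s := by
      rw [Matrix.trace_fin_two] at htr
      exact_mod_cast htr
    have hdet' : ((M 0 0 : ℝ) : ℂ) * (M 1 1 : ℝ) - (M 0 1 : ℝ) * (M 1 0 : ℝ) = r * s := by
      rw [Matrix.det_fin_two] at hdet
      exact_mod_cast hdet
    rw [spectrum.mem_iff, Matrix.isUnit_iff_isUnit_det, isUnit_iff_ne_zero, not_not,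
      Matrix.det_fin_two]
    simp only [Matrix.algebraMap_eq_diagonal, Matrix.sub_apply, Matrix.map_apply,
      Matrix.diagonal_apply_eq, Pi.algebraMap_apply, Algebra.algebraMap_self, RingHom.id_apply,
      Matrix.diagonal_apply_ne _ (zero_ne_one : (0 : Fin 2) ≠ 1),
      Matrix.diagonal_apply_ne _ (one_ne_zero : (1 : Fin 2) ≠ 0)]
    rw [← sub_eq_zero (b := (r : ℂ)), ← sub_eq_zero (b := (s : ℂ)), ← mul_eq_zero]
    constructor
    · intro h
      linear_combination h + z * htr' - hdet'
    · intro h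
      linear_combination h - z * htr' + hdet'
  have hr : 0 ≤ r := (abs_nonneg s).trans hrs
  have hnorm : ∀ x : ℝ, (‖(x : ℂ)‖₊ : ℝ≥0∞) = ENNReal.ofReal |x| := by
    intro x
    rw [← enorm_eq_nnnorm, ← ofReal_norm, Complex.norm_real, Real.norm_eq_abs]
  unfold sp spectralRadius
  refine le_antisymm (iSup₂_le fun z hz => ?_) ?_
  · rcases (hmem z).1 hz with rfl | rfl
    · rw [hnorm, abs_of_nonneg hr]
    · rw [hnorm]
      exact ENNReal.ofReal_le_ofReal hrs
  · refine le_trans ?_ (le_iSup₂ (f := fun (z : ℂ) _ => (‖z‖₊ : ℝ≥0∞)) (r : ℂ)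
      ((hmem r).2 (Or.inl rfl)))
    rw [hnorm, abs_of_nonneg hr]

theorem lt_critical_iff {l₂ p₁ p₂ : ℝ} (hp₁ : 0 ≤ p₁) (hp₂ : 0 ≤ p₂) :
    l₂ < p₂ * (1 - p₁) / (1 + p₁ * p₂) ↔ 0 < p₂ - l₂ - p₁ * p₂ - l₂ * p₁ * p₂ := by
  rw [lt_div_iff₀ (by positivity), ← sub_pos]
  ring_nf

theorem rateR_solves {l₂ p₁ p₂ : ℝ} (hl₂' : l₂ < 1) (hp₁' : p₁ < 1) (hp₂ : 0 < p₂) :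
    SolvesRateEquation (blockA₀ l₂ p₁ p₂) (blockA₁ l₂ p₁ p₂) (blockA₂ l₂ p₁ p₂)
      (rateR l₂ p₁ p₂) := by
  have h1 : (1 - l₂) ≠ 0 := by linarith
  have h2 : (1 - p₁) ≠ 0 := by linarith
  have h3 := hp₂.ne'
  unfold SolvesRateEquation
  ext i j
  fin_cases i <;> fin_cases j <;>
    simp [pow_two, Matrix.mul_apply, Fin.sum_univ_two, blockA₀, blockA₁, blockA₂, rateR] <;>
    field_simp <;> ring

/-- The determinant of R is nonpositive and its trace nonnegative, so the eigenvalues satisfy s ≤ 0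
≤ r and |s| ≤ r. -/
theorem sp_rateR {l₂ p₁ p₂ : ℝ} (hl₂ : 0 < l₂) (hl₂' : l₂ < 1) (hp₁ : 0 ≤ p₁) (hp₁' : p₁ < 1)
    (hp₂ : 0 < p₂) (hp₂' : p₂ ≤ 1) :
    sp (rateR l₂ p₁ p₂) = ENNReal.ofReal
        (l₂ * (1 - p₂ - l₂ * p₁ * p₂ + 2 * p₁ * p₂ +
            Real.sqrt (1 - 2 * p₂ + p₂ ^ 2 + 4 * p₁ * p₂ - 2 * l₂ * p₁ * p₂
              - 2 * l₂ * p₁ * p₂ ^ 2 + l₂ ^ 2 * p₁ ^ 2 * p₂ ^ 2)) /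
          (2 * p₂ * (1 - l₂ - p₁ + l₂ * p₁))) ∧
    (sp (rateR l₂ p₁ p₂) < 1 ↔ l₂ < p₂ * (1 - p₁) / (1 + p₁ * p₂)) := by
  have h1 : 0 < 1 - l₂ := by linarith
  have h2 : 0 < 1 - p₁ := by linarith
  have hc : 0 ≤ p₁ * p₂ := by positivity
  set D := (1 - l₂) * (1 - p₁) * p₂ with hD
  have hD0 : 0 < D := by positivity
  set Y := 1 - 2 * p₂ + p₂ ^ 2 + 4 * p₁ * p₂ - 2 * l₂ * p₁ * p₂
    - 2 * l₂ * p₁ * p₂ ^ 2 + l₂ ^ 2 * p₁ ^ 2 * p₂ ^ 2 with hY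
  set X := 1 - p₂ - l₂ * p₁ * p₂ + 2 * p₁ * p₂ with hX
  have hYX : Y = X ^ 2 + 4 * (p₁ * p₂) * D := by rw [hY, hX, hD]; ring
  have hX0 : 0 ≤ X := by
    rw [hX]
    nlinarith
  have hXY : X ^ 2 ≤ Y := by rw [hYX]; nlinarith [mul_nonneg hc hD0.le]
  set Q := Real.sqrt Y with hQ
  have hQ2 : Q ^ 2 = Y := Real.sq_sqrt ((sq_nonneg X).trans hXY)
  have hXQ : X ≤ Q := Real.le_sqrt_of_sq_le hXY
  have hden : 2 * p₂ * (1 - l₂ - p₁ + l₂ * p₁) = 2 * D := by rw [hD]; ring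
  rw [hden]
  set r := l₂ * (X + Q) / (2 * D) with hr
  set s := l₂ * (X - Q) / (2 * D) with hs
  have hs0 : s ≤ 0 :=
    div_nonpos_of_nonpos_of_nonneg (mul_nonpos_of_nonneg_of_nonpos hl₂.le (by linarith))
      (by linarith)
  have hrs : 0 ≤ r + s := by
    rw [hr, hs, ← add_div]
    apply div_nonneg _ (by linarith)
    nlinarith [mul_nonneg hl₂.le hX0]
  have hp : r * s = -(l₂ ^ 2 * (p₁ * p₂) / D) := by
    rw [hr, hs, div_mul_div_comm, show l₂ * (X + Q) * (l₂ * (X - Q)) = l₂ ^ 2 * (X ^ 2 - Q ^ 2) by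
      ring, hQ2, hYX]
    field_simp
    ring
  have hsum : r + s = l₂ * X / D := by
    rw [hr, hs]
    field_simp
    ring
  have hsp : sp (rateR l₂ p₁ p₂) = ENNReal.ofReal r := by
    refine sp_eq_of_trace_det (s := s) ?_ ?_ ?_
    · rw [hsum, Matrix.trace_fin_two]
      simp only [rateR, Matrix.of_apply, Matrix.cons_val', Matrix.cons_val_zero,
        Matrix.cons_val_one, Matrix.cons_val_fin_one]
      rw [hX, hD]
      field_simp
      ring
    · rw [hp, Matrix.det_fin_two]
      simp only [rateR, Matrix.of_apply, Matrix.cons_val', Matrix.cons_val_zero,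
        Matrix.cons_val_one, Matrix.cons_val_fin_one]
      rw [hD]
      field_simp
      ring
    · rw [abs_of_nonpos hs0]
      linarith
  refine ⟨hsp, ?_⟩
  rw [hsp, lt_critical_iff hp₁ hp₂.le, ENNReal.ofReal_lt_one]
  -- The characteristic polynomial of R at 1, scaled by D, is the critical quantity. Since 1 - s >
  -- 0, its sign is that of 1 - r.
  have hchar : (1 - r) * (1 - s) * D = p₂ - l₂ - p₁ * p₂ - l₂ * p₁ * p₂ := by
    have : (1 - r) * (1 - s) = 1 - (r + s) + r * s := by ring
    rw [this, hsum, hp]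
    field_simp
    rw [hX, hD]
    ring
  rw [← hchar, mul_pos_iff_of_pos_right hD0, mul_pos_iff_of_pos_right (by linarith), sub_pos]

/-- The bottom row of the equation expresses the bottom row of X as an increasing function of its
top row, so only the top row has to be compared with that of R. -/
theorem rateR_isRateMatrix {l₂ p₁ p₂ : ℝ} (hl₂ : 0 < l₂) (hl₂' : l₂ < 1) (hp₁ : 0 ≤ p₁)
    (hp₁' : p₁ < 1) (hp₂ : 0 < p₂) (hp₂' : p₂ ≤ 1)
    (hstab : 0 < p₂ - l₂ - p₁ * p₂ - l₂ * p₁ * p₂) :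
    IsRateMatrix (blockA₀ l₂ p₁ p₂) (blockA₁ l₂ p₁ p₂) (blockA₂ l₂ p₁ p₂) (rateR l₂ p₁ p₂) := by
  have h1 : 0 < 1 - l₂ := by linarith
  have h2 : 0 < 1 - p₁ := by linarith
  have hc : 0 ≤ p₁ * p₂ := by positivity
  have hs : 0 ≤ 1 - p₂ + p₁ * p₂ := by linarith
  have hD0 : 0 < (1 - l₂) * (1 - p₁) * p₂ := by positivity
  refine ⟨fun i j => ?_, rateR_solves hl₂' hp₁' hp₂, fun X hX hsol => ?_⟩
  · fin_cases i <;> fin_cases j <;> simp [rateR] <;> positivity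
  obtain ⟨x, y, z, t, rfl⟩ : ∃ x y z t, X = !![x, y; z, t] := ⟨_, _, _, _, Matrix.eta_fin_two X⟩
  have e00 := congrFun (congrFun hsol 0) 0
  have e01 := congrFun (congrFun hsol 0) 1
  have e10 := congrFun (congrFun hsol 1) 0
  have e11 := congrFun (congrFun hsol 1) 1
  simp [pow_two, Matrix.mul_apply, Fin.sum_univ_two, blockA₀, blockA₁, blockA₂] at e00 e01 e10 e11
  have x0 : 0 ≤ x := hX 0 0
  have y0 : 0 ≤ y := hX 0 1
  have x1 : 0 ≤ z := hX 1 0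
  have y1 : 0 ≤ t := hX 1 1
  obtain ⟨d, hd⟩ : ∃ d, d = (1 - l₂) * (1 - p₁) * p₂ := ⟨_, rfl⟩
  rw [← hd] at hD0
  have hz : z = p₁ * p₂ * l₂ + p₁ * p₂ * (1 - l₂) * x := by linear_combination -e10
  have ht : t = p₁ * p₂ * (1 - l₂) * y := by linear_combination -e11
  -- (w₀, w₁) is d times the top row of R - X. Adding the two rows of the rate equation shows that
  -- w(I - X) = 0, which is `f0` and `f1`; the goal is w ≤ 0.
  obtain ⟨w₀, hw₀⟩ : ∃ w, w = l₂ * (1 - p₂ + p₁ * p₂) - d * x := ⟨_, rfl⟩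
  obtain ⟨w₁, hw₁⟩ : ∃ w, w = l₂ - d * y := ⟨_, rfl⟩
  have f0 : w₀ * (1 - x) = w₁ * z := by
    rw [hw₀, hw₁, hd]
    linear_combination e00 + e10
  have f1 : w₀ * y = w₁ * (1 - t) := by
    rw [hw₀, hw₁, hd]
    linear_combination -e01 - e11
  have hlc : 0 ≤ p₁ * p₂ * l₂ := mul_nonneg hc hl₂.le
  -- This inequality is exactly the stability hypothesis rearranged.
  have hsd : l₂ * (1 - p₂ + p₁ * p₂) + p₁ * p₂ * l₂ < d := by
    rw [hd]
    linarith
  have hcd : p₁ * p₂ * (1 - l₂) * l₂ < d := by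
    have := mul_nonneg hlc hl₂.le
    have := mul_nonneg hl₂.le hs
    linarith
  have hx1 : 0 < w₀ → x < 1 := fun h => by
    have : d * x < d * 1 := by linarith
    exact lt_of_mul_lt_mul_left this hD0.le
  have ht1 : 0 < w₁ → t < 1 := fun h => by
    have h' : p₁ * p₂ * (1 - l₂) * (d * y) ≤ p₁ * p₂ * (1 - l₂) * l₂ :=
      mul_le_mul_of_nonneg_left (by linarith) (by positivity)
    have : d * t < d * 1 := by
      rw [ht]
      linarith
    exact lt_of_mul_lt_mul_left this hD0.le
  -- If both entries of X in the top row were smaller than those of R, then det(I - X) would be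
  -- positive, and w(I - X) = 0 would force w = 0.
  have hdet : 0 < w₀ → 0 < w₁ → z * y < (1 - x) * (1 - t) := by
    intro k0 k1
    have g : (1 - x) * (1 - t) - z * y = 1 - x - p₁ * p₂ * y := by
      rw [hz, ht]
      ring
    have g1 : d * (x + p₁ * p₂ * y) < d * 1 := by
      have : p₁ * p₂ * (d * y) ≤ p₁ * p₂ * l₂ := mul_le_mul_of_nonneg_left (by linarith) hc
      linarith
    linarith [lt_of_mul_lt_mul_left g1 hD0.le]
  have hw1 : w₁ ≤ 0 := by
    by_contra! k1
    have hlt := ht1 k1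
    have k0 : 0 < w₀ := by
      by_contra! k0
      linarith [mul_nonneg (neg_nonneg.2 k0) y0, mul_pos k1 (sub_pos.2 hlt)]
    have := hdet k0 k1
    have g : w₀ * ((1 - x) * (1 - t)) = w₀ * (z * y) := by
      linear_combination (1 - t) * f0 - z * f1
    have := mul_lt_mul_of_pos_left this k0
    linarith
  have hw0 : w₀ ≤ 0 := by
    by_contra! k0
    have := mul_pos k0 (sub_pos.2 (hx1 k0))
    linarith [mul_nonneg (neg_nonneg.2 hw1) x1]
  have r0 : l₂ * (1 - p₂ + p₁ * p₂) / d ≤ x := by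
    rw [div_le_iff₀ hD0]; linarith
  have r1 : l₂ / d ≤ y := by
    rw [div_le_iff₀ hD0]; linarith
  have r2 : l₂ * p₁ / (1 - p₁) ≤ z := by
    have : l₂ * p₁ / (1 - p₁) = p₁ * p₂ * l₂ + p₁ * p₂ * (1 - l₂) *
      (l₂ * (1 - p₂ + p₁ * p₂) / d) := by rw [hd]; field_simp; ring
    rw [this, hz]
    gcongr
  have r3 : l₂ * p₁ / (1 - p₁) ≤ t := by
    have : l₂ * p₁ / (1 - p₁) = p₁ * p₂ * (1 - l₂) * (l₂ / d) := by rw [hd]; field_simp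
    rw [this, ht]
    gcongr
  rw [hd] at r0 r1
  intro i j
  fin_cases i <;> fin_cases j
  exacts [r0, r1, r2, r3]

/-! ### The whole system -/

theorem isStochastic_of_slotProb {S : Type*} [DecidableEq S] {l₁ l₂ p₁ p₂ : ℝ}
    (hprob : ∀ ω : Slot, 0 ≤ ω.prob l₁ l₂ p₁ p₂) (g : S → Slot → S) :
    IsStochastic (fun x y => slotProb l₁ l₂ p₁ p₂ (fun ω => g x ω = y)) where
  nonneg x y := slotProb_nonneg hprob _
  hasSum x := by
    simpa [slotExp_one] using hasSum_slotProb_mul l₁ l₂ p₁ p₂ (g x) (fun _ => 1)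

theorem isStochastic_trans₂ {l₂ p₁ p₂ : ℝ} (hl₂ : 0 ≤ l₂) (hl₂' : l₂ ≤ 1) (hp₁ : 0 ≤ p₁)
    (hp₁' : p₁ ≤ 1) (hp₂ : 0 ≤ p₂) (hp₂' : p₂ ≤ 1) : IsStochastic (trans₂ l₂ p₁ p₂) :=
  isStochastic_of_slotProb (Slot.prob_nonneg le_rfl zero_le_one hl₂ hl₂' hp₁ hp₁' hp₂ hp₂') next₂

theorem isStochastic_sysTrans {l₁ l₂ p₁ p₂ : ℝ} (hprob : ∀ ω : Slot, 0 ≤ ω.prob l₁ l₂ p₁ p₂) :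
    IsStochastic (sysTrans l₁ l₂ p₁ p₂) :=
  isStochastic_of_slotProb hprob next

theorem serviceProb₁_nonneg {l₂ p₁ p₂ : ℝ} (hl₂ : 0 ≤ l₂) (hl₂' : l₂ ≤ 1) (hp₁ : 0 ≤ p₁)
    (hp₁' : p₁ ≤ 1) (hp₂ : 0 ≤ p₂) (hp₂' : p₂ ≤ 1) (z : State₂) :
    0 ≤ serviceProb₁ l₂ p₁ p₂ z :=
  slotProb_nonneg (Slot.prob_nonneg le_rfl zero_le_one hl₂ hl₂' hp₁ hp₁' hp₂ hp₂') _

theorem serviceProb₁_le_one {l₂ p₁ p₂ : ℝ} (hl₂ : 0 ≤ l₂) (hp₁ : 0 ≤ p₁)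
    (hp₁' : p₁ ≤ 1) (hp₂ : 0 ≤ p₂) (z : State₂) : serviceProb₁ l₂ p₁ p₂ z ≤ 1 := by
  have := mul_nonneg hp₁ hp₂
  have := mul_nonneg this hl₂
  obtain ⟨k, j⟩ := z
  fin_cases j
  · cases k with
    | zero =>
      simp only [Fin.zero_eta, serviceProb₁_zero]
      linarith
    | succ k =>
      simp only [Fin.zero_eta, serviceProb₁_succ]
      linarith
  · exact (serviceProb₁_off l₂ p₁ p₂ k).le

/-- The law of queue 1 after one slot: arrival and service are independent. -/
theorem slotExp_next_fst (l₁ l₂ p₁ p₂ : ℝ) (f : ℕ → ℝ) (q : ℕ) (z : State₂) :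
    slotExp l₁ l₂ p₁ p₂ (fun ω => f (next (q, z) ω).1)
      = (l₁ * serviceProb₁ l₂ p₁ p₂ z + (1 - l₁) * (1 - serviceProb₁ l₂ p₁ p₂ z)) * f q
        + l₁ * (1 - serviceProb₁ l₂ p₁ p₂ z) * f (q + 1)
        + (1 - l₁) * serviceProb₁ l₂ p₁ p₂ z * f (q - 1) := by
  obtain ⟨k, j⟩ := z
  fin_cases j
  · cases k with
    | zero =>
      simp only [Fin.zero_eta, serviceProb₁_zero]
      simp [slotExp, next, served₁, tx₁, tx₂, Slot.prob, bern]
      ring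
    | succ k =>
      simp only [Fin.zero_eta, serviceProb₁_succ]
      simp [slotExp, next, served₁, tx₁, tx₂, Slot.prob, bern]
      ring
  · simp only [Fin.mk_one, serviceProb₁_off]
    simp [slotExp, next, served₁, tx₁, tx₂, Slot.prob, bern]
    ring

/-! ### The marginal of queue 2 and flow balance for queue 1. -/

section Marginal

variable {l₁ l₂ p₁ p₂ : ℝ}

/-- The change of the mean of a function of queue 1 in one slot. -/
theorem tsum_sysTrans_step (hprob : ∀ ω : Slot, 0 ≤ ω.prob l₁ l₂ p₁ p₂) (W : State → ℝ≥0∞)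
    {f : ℕ → ℝ} (hf : ∀ q, 0 ≤ f q) :
    ∑' y : State, (∑' x, W x * ENNReal.ofReal (sysTrans l₁ l₂ p₁ p₂ x y)) * ENNReal.ofReal (f y.1)
      = ∑' x : State, W x * ENNReal.ofReal
          ((l₁ * serviceProb₁ l₂ p₁ p₂ x.2 + (1 - l₁) * (1 - serviceProb₁ l₂ p₁ p₂ x.2)) * f x.1
            + l₁ * (1 - serviceProb₁ l₂ p₁ p₂ x.2) * f (x.1 + 1)
            + (1 - l₁) * serviceProb₁ l₂ p₁ p₂ x.2 * f (x.1 - 1)) := by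
  simp_rw [← ENNReal.tsum_mul_right]
  rw [ENNReal.tsum_comm]
  refine tsum_congr fun x => ?_
  simp_rw [mul_assoc, ENNReal.tsum_mul_left]
  congr 1
  have h := tsum_ofReal_slotProb_mul hprob (next x) (fun y => ENNReal.ofReal (f y.1))
  rw [slotLExp_ofReal hprob (f := fun ω => f (next x ω).1) (fun _ => hf _),
    slotExp_next_fst] at h
  simp_rw [← mul_assoc]
  exact h

/-- The marginal of queue 2 evolves by its own transition probabilities. -/
theorem tsum_fst_sysTrans (hprob : ∀ ω : Slot, 0 ≤ ω.prob l₁ l₂ p₁ p₂) (W : State → ℝ≥0∞)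
    (z' : State₂) :
    ∑' q', ∑' x, W x * ENNReal.ofReal (sysTrans l₁ l₂ p₁ p₂ x (q', z'))
      = ∑' z, (∑' q, W (q, z)) * ENNReal.ofReal (trans₂ l₂ p₁ p₂ z z') := by
  have h : ∀ x : State, ∑' q', ENNReal.ofReal (sysTrans l₁ l₂ p₁ p₂ x (q', z'))
      = ENNReal.ofReal (trans₂ l₂ p₁ p₂ x.2 z') := by
    rintro ⟨q, z⟩
    have hs := hasSum_sysTrans_fst l₁ l₂ p₁ p₂ q z z'
    rw [← ENNReal.ofReal_tsum_of_nonneg (fun q' => (isStochastic_sysTrans hprob).nonneg _ _)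
      hs.summable, hs.tsum_eq]
  rw [ENNReal.tsum_comm]
  simp_rw [ENNReal.tsum_mul_left, h]
  rw [ENNReal.tsum_prod', ENNReal.tsum_comm]
  simp_rw [ENNReal.tsum_mul_right]

theorem tsum_mul_snd (W : State → ℝ≥0∞) (g : State₂ → ℝ≥0∞) :
    ∑' x : State, W x * g x.2 = ∑' z, (∑' q, W (q, z)) * g z := by
  rw [ENNReal.tsum_prod', ENNReal.tsum_comm]
  simp_rw [ENNReal.tsum_mul_right]

theorem tsum_ofReal_mul_serviceProb₁ (hl₂ : 0 < l₂) (hl₂' : l₂ < 1)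
    (hp₁ : 0 ≤ p₁) (hp₁' : p₁ < 1) (hp₂ : 0 ≤ p₂) (hp₂' : p₂ ≤ 1) {v : State₂ → ℝ}
    (hv : IsStationary (trans₂ l₂ p₁ p₂) v) :
    ∑' z, ENNReal.ofReal (v z) * ENNReal.ofReal (serviceProb₁ l₂ p₁ p₂ z)
      = ENNReal.ofReal (p₁ * (1 - p₁ - l₂ * p₁) / (1 - p₁)) := by
  have h := hv.hasSum_serviceProb₁ hl₂ hl₂' hp₁ hp₁' hp₂
  simp_rw [← ENNReal.ofReal_mul (hv.1 _)]
  rw [← ENNReal.ofReal_tsum_of_nonneg (fun z => mul_nonneg (hv.1 z)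
    (serviceProb₁_nonneg hl₂.le hl₂'.le hp₁ hp₁'.le hp₂ hp₂' z)) h.summable, h.tsum_eq]

theorem IsStationary.marginal (hl₂ : 0 ≤ l₂) (hl₂' : l₂ ≤ 1) (hp₁ : 0 ≤ p₁)
    (hp₁' : p₁ ≤ 1) (hp₂ : 0 ≤ p₂) (hp₂' : p₂ ≤ 1)
    (hprob : ∀ ω : Slot, 0 ≤ ω.prob l₁ l₂ p₁ p₂) {v : State → ℝ}
    (hv : IsStationary (sysTrans l₁ l₂ p₁ p₂) v) :
    IsStationary (trans₂ l₂ p₁ p₂) (fun z => (∑' q, ENNReal.ofReal (v (q, z))).toReal) := by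
  refine isStationary_toReal (isStochastic_trans₂ hl₂ hl₂' hp₁ hp₁' hp₂ hp₂') ?_ fun z' => ?_
  · rw [ENNReal.tsum_comm, ← ENNReal.tsum_prod' (f := fun x : State => ENNReal.ofReal (v x))]
    exact hv.tsum_ofReal
  · rw [← tsum_fst_sysTrans hprob (fun x => ENNReal.ofReal (v x))]
    simp_rw [hv.tsum_mul (isStochastic_sysTrans hprob)]

/-- Balance of the flows between adjacent lengths of queue 1: in equilibrium the arrival rate
is the service rate minus the rate of dummy packets. -/
theorem IsStationary.arrival_add_dummy (hl₁ : 0 ≤ l₁) (hl₁' : l₁ ≤ 1) (hl₂ : 0 < l₂)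
    (hl₂' : l₂ < 1) (hp₁ : 0 ≤ p₁) (hp₁' : p₁ < 1) (hp₂ : 0 ≤ p₂) (hp₂' : p₂ ≤ 1) {v : State → ℝ}
    (hv : IsStationary (sysTrans l₁ l₂ p₁ p₂) v) :
    ENNReal.ofReal l₁ + ∑' x : State, ENNReal.ofReal (v x) *
        ENNReal.ofReal (if x.1 = 0 then (1 - l₁) * serviceProb₁ l₂ p₁ p₂ x.2 else 0)
      = ENNReal.ofReal (p₁ * (1 - p₁ - l₂ * p₁) / (1 - p₁)) := by
  have hprob := Slot.prob_nonneg hl₁ hl₁' hl₂.le hl₂'.le hp₁ hp₁'.le hp₂ hp₂'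
  have hP := isStochastic_sysTrans hprob
  have hs0 := serviceProb₁_nonneg hl₂.le hl₂'.le hp₁ hp₁'.le hp₂ hp₂'
  have hs1 := serviceProb₁_le_one hl₂.le hp₁ hp₁'.le hp₂
  set s := serviceProb₁ l₂ p₁ p₂ with hs
  set W : State → ℝ≥0∞ := fun x => ENNReal.ofReal (v x) with hW
  have hl : 0 ≤ 1 - l₁ := sub_nonneg.2 hl₁'
  have hup : ∀ z, 0 ≤ l₁ * (1 - s z) := fun z => mul_nonneg hl₁ (sub_nonneg.2 (hs1 z))
  have hdown : ∀ z, 0 ≤ (1 - l₁) * s z := fun z => mul_nonneg hl (hs0 z)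
  -- The test function is the indicator of q ≤ n. Being bounded, it requires no finite mean length
  -- of queue 1 under `v`.
  have hcut : ∀ n : ℕ, ∑' x : State, W x * ENNReal.ofReal (if x.1 = n then l₁ * (1 - s x.2) else 0)
      = ∑' x : State, W x * ENNReal.ofReal (if x.1 = n + 1 then (1 - l₁) * s x.2 else 0) := by
    intro n
    have hf : ∀ q : ℕ, (0 : ℝ) ≤ if q ≤ n then 1 else 0 := fun q => by split_ifs <;> norm_num
    have h := tsum_sysTrans_step hprob W hf
    simp_rw [hW, hv.tsum_mul hP] at h
    have hne : ∑' y : State, W y * ENNReal.ofReal (if y.1 ≤ n then 1 else 0) ≠ ∞ := by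
      refine ne_top_of_le_ne_top ENNReal.one_ne_top ?_
      rw [← hv.tsum_ofReal]
      refine ENNReal.tsum_le_tsum fun y => mul_le_of_le_one_right' ?_
      split_ifs <;> simp
    refine (ENNReal.add_right_inj hne).1 ?_
    conv_lhs => rw [hW, h]
    rw [← ENNReal.tsum_add, ← ENNReal.tsum_add]
    refine tsum_congr fun x => ?_
    rw [← mul_add, ← mul_add, ← ENNReal.ofReal_add, ← ENNReal.ofReal_add (hf _)]
    · congr 2
      rw [← hs]
      obtain ⟨q, z⟩ := x
      simp only
      rcases lt_trichotomy q n with hq | rfl | hq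
      · rw [if_pos hq.le, if_pos (show q + 1 ≤ n by omega), if_pos (show q - 1 ≤ n by omega),
          if_neg hq.ne, if_neg (show q ≠ n + 1 by omega)]
        ring
      · rw [if_pos le_rfl, if_neg (show ¬ q + 1 ≤ q by omega), if_pos (show q - 1 ≤ q by omega),
          if_pos rfl, if_neg (show q ≠ q + 1 by omega)]
        ring
      · rw [if_neg (show ¬ q ≤ n by omega), if_neg (show ¬ q + 1 ≤ n by omega),
          if_neg (show q ≠ n by omega)]
        by_cases hq' : q = n + 1
        · rw [if_pos (show q - 1 ≤ n by omega), if_pos hq']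
          ring
        · rw [if_neg (show ¬ q - 1 ≤ n by omega), if_neg hq']
          ring
    · split_ifs
      exacts [hdown _, le_rfl]
    · have h1 := hup x.2
      have h2 := hdown x.2
      have h3 := mul_nonneg hl₁ (hs0 x.2)
      have h4 := mul_nonneg hl (sub_nonneg.2 (hs1 x.2))
      have h5 := hf x.1
      have h6 := hf (x.1 + 1)
      have h7 := hf (x.1 - 1)
      rw [← hs]
      positivity
    · split_ifs
      exacts [hup _, le_rfl]
  -- Summing over all cuts: the total upward flow equals the downward flow from nonempty queue 1,
  -- and what is missing at q = 0 are the dummy packets.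
  have hsum := tsum_congr (L := .unconditional ℕ) hcut
  rw [ENNReal.tsum_comm, ENNReal.tsum_comm (α := ℕ)] at hsum
  simp_rw [ENNReal.tsum_mul_left] at hsum
  have hupsum : ∀ x : State, ∑' n, ENNReal.ofReal (if x.1 = n then l₁ * (1 - s x.2) else 0)
      = ENNReal.ofReal (l₁ * (1 - s x.2)) := by
    intro x
    rw [tsum_eq_single x.1 (fun n hn => by rw [if_neg (Ne.symm hn), ENNReal.ofReal_zero]),
      if_pos rfl]
  have hdownsum : ∀ x : State,
      ENNReal.ofReal (if x.1 = 0 then (1 - l₁) * s x.2 else 0)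
        + ∑' n, ENNReal.ofReal (if x.1 = n + 1 then (1 - l₁) * s x.2 else 0)
      = ENNReal.ofReal ((1 - l₁) * s x.2) := by
    intro x
    rw [← tsum_eq_zero_add' (f := fun n => ENNReal.ofReal (if x.1 = n then (1 - l₁) * s x.2 else 0))
      ENNReal.summable,
      tsum_eq_single x.1 (fun n hn => by rw [if_neg (Ne.symm hn), ENNReal.ofReal_zero]),
      if_pos rfl]
  have hmarg := tsum_ofReal_mul_serviceProb₁ hl₂ hl₂' hp₁ hp₁' hp₂ hp₂'
    (hv.marginal hl₂.le hl₂'.le hp₁ hp₁'.le hp₂ hp₂' hprob)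
  have hMfin : ∀ z, ∑' q, W (q, z) ≠ ∞ := fun z => by
    refine ne_top_of_le_ne_top ENNReal.one_ne_top ?_
    rw [← hv.tsum_ofReal, ENNReal.tsum_prod', ENNReal.tsum_comm]
    exact ENNReal.le_tsum z
  rw [tsum_congr fun z => congrArg (· * ENNReal.ofReal (serviceProb₁ l₂ p₁ p₂ z))
    (ENNReal.ofReal_toReal (hMfin z)), ← hs] at hmarg
  rw [← tsum_mul_snd W (fun z => ENNReal.ofReal (s z))] at hmarg
  have hone : ENNReal.ofReal l₁ = ∑' x, W x * ENNReal.ofReal l₁ := by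
    rw [ENNReal.tsum_mul_right, hv.tsum_ofReal, one_mul]
  simp_rw [hupsum] at hsum
  have hl₁s : ∀ x : State, ENNReal.ofReal l₁
      = ENNReal.ofReal (l₁ * (1 - s x.2)) + ENNReal.ofReal (l₁ * s x.2) := fun x => by
    rw [← ENNReal.ofReal_add (hup _) (mul_nonneg hl₁ (hs0 _))]
    congr 1
    ring
  have hss : ∀ x : State, ENNReal.ofReal (s x.2)
      = ENNReal.ofReal ((1 - l₁) * s x.2) + ENNReal.ofReal (l₁ * s x.2) := fun x => by
    rw [← ENNReal.ofReal_add (hdown _) (mul_nonneg hl₁ (hs0 _))]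
    congr 1
    ring
  rw [hone, ← hmarg, tsum_congr fun x => congrArg (W x * ·) (hl₁s x),
    tsum_congr fun x => congrArg (W x * ·) (hss x)]
  simp_rw [← hdownsum, mul_add, ENNReal.tsum_add]
  rw [hsum]
  abel

end Marginal

theorem sysTrans_pos {l₁ l₂ p₁ p₂ : ℝ} (hprob : ∀ ω : Slot, 0 ≤ ω.prob l₁ l₂ p₁ p₂) {x y : State}
    (ω : Slot) (hω : 0 < ω.prob l₁ l₂ p₁ p₂) (h : next x ω = y) :
    0 < sysTrans l₁ l₂ p₁ p₂ x y :=
  hω.trans_le (prob_le_slotProb hprob (fun ω => next x ω = y) ω h)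

/-- Both queues can empty. -/
theorem reachable_origin {l₁ l₂ p₁ p₂ : ℝ} (hl₁ : 0 ≤ l₁) (hl₁' : l₁ < 1) (hl₂ : 0 ≤ l₂)
    (hl₂' : l₂ < 1) (hp₁ : 0 < p₁) (hp₁' : p₁ < 1) (hp₂ : 0 < p₂) (hp₂' : p₂ ≤ 1) (x : State) :
    Reachable (sysTrans l₁ l₂ p₁ p₂) x (0, (0, 0)) := by
  have hprob := Slot.prob_nonneg hl₁ hl₁'.le hl₂ hl₂'.le hp₁.le hp₁'.le hp₂.le hp₂'
  have h1 : 0 < 1 - l₁ := sub_pos.2 hl₁'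
  have h2 : 0 < 1 - l₂ := sub_pos.2 hl₂'
  have h3 : 0 < 1 - p₁ := sub_pos.2 hp₁'
  -- Queue 2 always decides to access in these slots, because p₂ = 1 is allowed. Only the decision
  -- of queue 1 varies: it stays silent to drain queue 2, and transmits to drain itself once queue 2
  -- is empty.
  have hpos : ∀ t₁ : Bool, 0 < Slot.prob l₁ l₂ p₁ p₂ ⟨false, false, t₁, true⟩ := by
    intro t₁
    cases t₁ <;> simp [Slot.prob, bern] <;> positivity
  have hempty : ∀ q, Reachable (sysTrans l₁ l₂ p₁ p₂) (q, (0, 0)) (0, (0, 0)) := by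
    intro q
    induction q with
    | zero => exact Relation.ReflTransGen.refl
    | succ q ih =>
      refine Relation.ReflTransGen.head (sysTrans_pos hprob _ (hpos true) ?_) ih
      simp [next, next₂, served₁, served₂, tx₁, tx₂]
  have hon : ∀ q k, Reachable (sysTrans l₁ l₂ p₁ p₂) (q, (k, 0)) (0, (0, 0)) := by
    intro q k
    induction k with
    | zero => exact hempty q
    | succ k ih =>
      refine Relation.ReflTransGen.head (sysTrans_pos hprob _ (hpos false) ?_) ih
      simp [next, next₂, served₁, served₂, tx₁, tx₂]
  obtain ⟨q, k, j⟩ := x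
  fin_cases j
  · exact hon q k
  · refine Relation.ReflTransGen.head (sysTrans_pos hprob _ (hpos true) ?_) (hon (q - 1) k)
    simp [next, next₂, served₁, served₂, tx₁, tx₂]

/-- A drift argument along the trajectory started with queue 1 empty and queue 2 in its stationary
law; the marginal of queue 2 then never changes, so queue 1 is served with probability μ in every
slot. -/
theorem exists_isStationary_sysTrans {l₁ l₂ p₁ p₂ : ℝ} (hl₁ : 0 ≤ l₁) (hl₁' : l₁ < 1)
    (hl₂ : 0 < l₂) (hl₂' : l₂ < 1) (hp₁ : 0 ≤ p₁) (hp₁' : p₁ < 1) (hp₂ : 0 ≤ p₂) (hp₂' : p₂ ≤ 1)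
    {v : State₂ → ℝ} (hv : IsStationary (trans₂ l₂ p₁ p₂) v)
    (hμ : l₁ < p₁ * (1 - p₁ - l₂ * p₁) / (1 - p₁)) :
    ∃ w, IsStationary (sysTrans l₁ l₂ p₁ p₂) w ∧ 0 < w (0, (0, 0)) := by
  have hprob := Slot.prob_nonneg hl₁ hl₁'.le hl₂.le hl₂'.le hp₁ hp₁'.le hp₂ hp₂'
  have hP := isStochastic_sysTrans hprob
  have hP₂ := isStochastic_trans₂ hl₂.le hl₂'.le hp₁ hp₁'.le hp₂ hp₂'
  have hs0 := serviceProb₁_nonneg hl₂.le hl₂'.le hp₁ hp₁'.le hp₂ hp₂'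
  have hs1 := serviceProb₁_le_one hl₂.le hp₁ hp₁'.le hp₂
  have hservice := tsum_ofReal_mul_serviceProb₁ hl₂ hl₂' hp₁ hp₁' hp₂ hp₂' hv
  set s := serviceProb₁ l₂ p₁ p₂ with hs
  set μ := p₁ * (1 - p₁ - l₂ * p₁) / (1 - p₁) with hμ'
  have hl : 0 ≤ 1 - l₁ := sub_nonneg.2 hl₁'.le
  set w : ℕ → State → ℝ≥0∞ := fun n => Nat.rec
    (fun x => if x.1 = 0 then ENNReal.ofReal (v x.2) else 0)
    (fun _ u y => ∑' x, u x * ENNReal.ofReal (sysTrans l₁ l₂ p₁ p₂ x y)) n with hw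
  have hw0 : ∀ x, w 0 x = if x.1 = 0 then ENNReal.ofReal (v x.2) else 0 := fun _ => rfl
  have hwsucc : ∀ n y, w (n + 1) y = ∑' x, w n x * ENNReal.ofReal (sysTrans l₁ l₂ p₁ p₂ x y) :=
    fun _ _ => rfl
  clear_value w
  have hmarg : ∀ n z, ∑' q, w n (q, z) = ENNReal.ofReal (v z) := by
    intro n
    induction n with
    | zero =>
      intro z
      simp_rw [hw0]
      exact tsum_ite_eq 0 _
    | succ n ih =>
      intro z
      simp_rw [hwsucc]
      rw [tsum_fst_sysTrans hprob]
      simp_rw [ih]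
      exact hv.tsum_mul hP₂ z
  have hmass : ∀ n, ∑' x, w n x = 1 := by
    intro n
    rw [ENNReal.tsum_prod', ENNReal.tsum_comm]
    simp_rw [hmarg]
    exact hv.tsum_ofReal
  have hdrift : ∀ n, ∑' x : State, w (n + 1) x * ENNReal.ofReal (x.1 : ℝ) + ENNReal.ofReal μ
      = ∑' x : State, w n x * ENNReal.ofReal (x.1 : ℝ) + ENNReal.ofReal l₁ +
        ∑' x : State, w n x * ENNReal.ofReal (if x.1 = 0 then (1 - l₁) * s x.2 else 0) := by
    intro n
    have hone : ENNReal.ofReal l₁ = ∑' x, w n x * ENNReal.ofReal l₁ := by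
      rw [ENNReal.tsum_mul_right, hmass, one_mul]
    have hμs : ENNReal.ofReal μ = ∑' x : State, w n x * ENNReal.ofReal (s x.2) := by
      rw [tsum_mul_snd _ (fun z => ENNReal.ofReal (s z))]
      simp_rw [hmarg]
      exact hservice.symm
    rw [hone, hμs]
    simp_rw [hwsucc]
    rw [tsum_sysTrans_step hprob (w n) (f := fun q => (q : ℝ)) (fun q => Nat.cast_nonneg q),
      ← ENNReal.tsum_add, ← ENNReal.tsum_add, ← ENNReal.tsum_add]
    refine tsum_congr fun x => ?_
    rw [← hs, ← mul_add, ← mul_add, ← mul_add, ← ENNReal.ofReal_add _ (hs0 _),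
      ← ENNReal.ofReal_add (Nat.cast_nonneg _) hl₁, ← ENNReal.ofReal_add]
    · congr 2
      obtain ⟨_ | q, z⟩ := x
      · simp
        ring
      · simp
        ring
    · positivity
    · split_ifs
      exacts [mul_nonneg hl (hs0 _), le_rfl]
    · have h1 := mul_nonneg hl₁ (sub_nonneg.2 (hs1 x.2))
      have h2 := mul_nonneg hl (hs0 x.2)
      have h3 := mul_nonneg hl₁ (hs0 x.2)
      have h4 := mul_nonneg hl (sub_nonneg.2 (hs1 x.2))
      positivity
  -- The balance is written additively in `ℝ≥0∞`. The mean of queue 1 is later simply dropped, so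
  -- its finiteness is not needed.
  have hmean : ∀ N : ℕ, ∑' x : State, w N x * ENNReal.ofReal (x.1 : ℝ) + N * ENNReal.ofReal μ
      = N * ENNReal.ofReal l₁ + ∑ n ∈ Finset.range N,
        ∑' x : State, w n x * ENNReal.ofReal (if x.1 = 0 then (1 - l₁) * s x.2 else 0) := by
    intro N
    induction N with
    | zero =>
      have : ∀ x : State, w 0 x * ENNReal.ofReal (x.1 : ℝ) = 0 := by
        rintro ⟨_ | q, z⟩ <;> simp [hw0]
      rw [tsum_congr this]
      simp
    | succ N ih =>
      rw [Finset.sum_range_succ, Nat.cast_succ, add_mul, one_mul, add_comm (_ * ENNReal.ofReal μ),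
        ← add_assoc, hdrift, add_mul, one_mul]
      calc _ = (∑' x : State, w N x * ENNReal.ofReal (x.1 : ℝ) + N * ENNReal.ofReal μ)
            + ENNReal.ofReal l₁ + ∑' x : State, w N x *
              ENNReal.ofReal (if x.1 = 0 then (1 - l₁) * s x.2 else 0) := by abel
        _ = _ := by rw [ih]; abel
  -- Half of the drift gap μ - l₁ pays for the states of queue 2 outside the finite set `G`; the
  -- other half remains as the fraction of time spent in {0} × `G`.
  set ε : ℝ := (μ - l₁) / 2 with hε
  have hε0 : 0 < ε := by rw [hε]; linarith
  obtain ⟨G, hG⟩ : ∃ G : Finset State₂,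
      ∑' z : {z // z ∉ G}, ENNReal.ofReal (v z) ≤ ENNReal.ofReal ε := by
    have h := ENNReal.tendsto_tsum_compl_atTop_zero (f := fun z => ENNReal.ofReal (v z))
      (by rw [hv.tsum_ofReal]; exact ENNReal.one_ne_top)
    exact (h.eventually_le_const (ENNReal.ofReal_pos.2 hε0)).exists
  have hdummy : ∀ n, ∑' x : State, w n x *
      ENNReal.ofReal (if x.1 = 0 then (1 - l₁) * s x.2 else 0)
        ≤ ∑ y ∈ ({0} : Finset ℕ) ×ˢ G, w n y + ENNReal.ofReal ε := by
    intro n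
    have h1 : ∑' x : State, w n x * ENNReal.ofReal (if x.1 = 0 then (1 - l₁) * s x.2 else 0)
        ≤ ∑' z, w n (0, z) := by
      rw [ENNReal.tsum_prod', ENNReal.tsum_comm]
      refine ENNReal.tsum_le_tsum fun z => ?_
      rw [tsum_eq_single 0 (fun q hq => by simp [hq])]
      refine mul_le_of_le_one_right' ?_
      rw [if_pos rfl, ENNReal.ofReal_le_one]
      exact mul_le_one₀ (by linarith) (hs0 z) (hs1 z)
    refine h1.trans ?_
    rw [← ENNReal.summable.tsum_add_tsum_compl (s := (G : Set State₂)) ENNReal.summable,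
      Finset.sum_product, Finset.sum_singleton]
    refine add_le_add ?_ ?_
    · rw [Finset.tsum_subtype' G (fun z => w n (0, z))]
    · refine le_trans (ENNReal.tsum_le_tsum fun z => ?_) hG
      rw [← hmarg n]
      exact ENNReal.le_tsum (f := fun q => w n (q, _)) 0
  have hF : ∀ N : ℕ, N * ENNReal.ofReal ε
      ≤ ∑ n ∈ Finset.range N, ∑ y ∈ ({0} : Finset ℕ) ×ˢ G, w n y := by
    intro N
    have h1 : (N : ℝ≥0∞) * ENNReal.ofReal μ ≤ N * ENNReal.ofReal l₁ + ∑ n ∈ Finset.range N,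
        (∑ y ∈ ({0} : Finset ℕ) ×ˢ G, w n y + ENNReal.ofReal ε) := by
      refine le_trans le_add_self ((hmean N).le.trans ?_)
      gcongr with n
      exact hdummy n
    have h2 : ENNReal.ofReal μ = ENNReal.ofReal l₁ + ENNReal.ofReal ε + ENNReal.ofReal ε := by
      rw [← ENNReal.ofReal_add hl₁ hε0.le, ← ENNReal.ofReal_add (by linarith) hε0.le]
      congr 1
      rw [hε]
      ring
    rw [h2, Finset.sum_add_distrib, Finset.sum_const, Finset.card_range, nsmul_eq_mul, mul_add,
      mul_add, add_assoc, ENNReal.add_le_add_iff_left (by finiteness),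
      ENNReal.add_le_add_iff_right (by finiteness)] at h1
    exact h1
  obtain ⟨u, hu, y, -, hy⟩ := exists_isStationary_of_le_sum hP (hmass 0) hwsucc
    (by simpa using hε0) hF
  have hp₁0 : 0 < p₁ := by
    refine lt_of_le_of_ne hp₁ fun h => ?_
    rw [hμ', ← h] at hμ
    simp at hμ
    linarith
  have hp₂0 := (hv.trans₂_critical hl₂ hl₂' hp₁' hp₂).1
  exact ⟨u, hu, hu.pos_of_reachable hP hy
    (reachable_origin hl₁ hl₁' hl₂.le hl₂' hp₁0 hp₁' hp₂0 hp₂' y)⟩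

theorem stable_sysTrans_iff {l₁ l₂ p₁ p₂ : ℝ} (hl₁ : 0 < l₁) (hl₁' : l₁ < 1)
    (hl₂ : 0 < l₂) (hl₂' : l₂ < 1) (hp₁ : 0 ≤ p₁) (hp₁' : p₁ < 1) (hp₂ : 0 ≤ p₂)
    (hp₂' : p₂ ≤ 1) :
    Stable (sysTrans l₁ l₂ p₁ p₂) (0, (0, 0)) ↔
      l₁ < p₁ * (1 - p₁ - l₂ * p₁) / (1 - p₁) ∧ ∃ v, IsStationary (trans₂ l₂ p₁ p₂) v := by
  have hprob := Slot.prob_nonneg hl₁.le hl₁'.le hl₂.le hl₂'.le hp₁ hp₁'.le hp₂ hp₂'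
  rw [stable_iff_exists_isStationary (isStochastic_sysTrans hprob)]
  constructor
  · rintro ⟨v, hv, hpos⟩
    refine ⟨?_, _, hv.marginal hl₂.le hl₂'.le hp₁ hp₁'.le hp₂ hp₂' hprob⟩
    have h := hv.arrival_add_dummy hl₁.le hl₁'.le hl₂ hl₂' hp₁ hp₁' hp₂ hp₂'
    -- With p₁ = 0 the service rate vanishes, and the flow balance contradicts l₁ > 0.
    have hp₁0 : 0 < p₁ := by
      refine lt_of_le_of_ne hp₁ fun h0 => ?_
      rw [← h0] at h
      simp at h
      linarith
    have h0 : 0 < (1 - l₁) * serviceProb₁ l₂ p₁ p₂ (0, 0) := by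
      rw [serviceProb₁_zero, show p₁ * (1 - p₂) + p₁ * p₂ * (1 - l₂)
        = p₁ * ((1 - p₂) + p₂ * (1 - l₂)) by ring]
      have : 0 < (1 - p₂) + p₂ * (1 - l₂) := by nlinarith
      have : 0 < 1 - l₁ := by linarith
      positivity
    have hZ : 0 < ∑' x : State, ENNReal.ofReal (v x) *
        ENNReal.ofReal (if x.1 = 0 then (1 - l₁) * serviceProb₁ l₂ p₁ p₂ x.2 else 0) := by
      refine lt_of_lt_of_le ?_ (ENNReal.le_tsum ((0, (0, 0)) : State))
      rw [if_pos rfl]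
      exact ENNReal.mul_pos (by simpa using hpos) (by simpa using h0)
    have hlt := ENNReal.lt_add_right ENNReal.ofReal_ne_top hZ.ne' (a := ENNReal.ofReal l₁)
    rw [h] at hlt
    exact (ENNReal.ofReal_lt_ofReal_iff_of_nonneg hl₁.le).1 hlt
  · rintro ⟨hμ, v, hv⟩
    exact exists_isStationary_sysTrans hl₁.le hl₁' hl₂ hl₂' hp₁ hp₁' hp₂ hp₂' hv hμ

theorem exists_isStationary_trans₂_iff {l₂ p₁ p₂ : ℝ} (hl₂ : 0 < l₂) (hl₂' : l₂ < 1)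
    (hp₁ : 0 ≤ p₁) (hp₁' : p₁ < 1) (hp₂ : 0 ≤ p₂) (hp₂' : p₂ ≤ 1) :
    (∃ v, IsStationary (trans₂ l₂ p₁ p₂) v) ↔ l₂ < p₂ * (1 - p₁) / (1 + p₁ * p₂) := by
  rw [lt_critical_iff hp₁ hp₂]
  constructor
  · rintro ⟨v, hv⟩
    exact (hv.trans₂_critical hl₂ hl₂' hp₁' hp₂).2.1
  · intro h
    have := mul_nonneg hp₁ hp₂
    have := mul_nonneg hl₂.le this
    exact exists_isStationary_trans₂ hl₂ hl₂' hp₁ hp₁' (by linarith) hp₂' h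

theorem stable_trans₂_iff {l₂ p₁ p₂ : ℝ} (hl₂ : 0 < l₂) (hl₂' : l₂ < 1)
    (hp₁ : 0 ≤ p₁) (hp₁' : p₁ < 1) (hp₂ : 0 ≤ p₂) (hp₂' : p₂ ≤ 1) :
    Stable (trans₂ l₂ p₁ p₂) (0, 0) ↔ l₂ < p₂ * (1 - p₁) / (1 + p₁ * p₂) := by
  rw [← exists_isStationary_trans₂_iff hl₂ hl₂' hp₁ hp₁' hp₂ hp₂',
    stable_iff_exists_isStationary (isStochastic_trans₂ hl₂.le hl₂'.le hp₁ hp₁'.le hp₂ hp₂')]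
  exact ⟨fun ⟨v, hv, _⟩ => ⟨v, hv⟩,
    fun ⟨v, hv⟩ => ⟨v, hv, (hv.trans₂_critical hl₂ hl₂' hp₁' hp₂).2.2⟩⟩

end DomSys

open DomSys in
theorem lemma2 (l₁ l₂ p₁ p₂ : ℝ)
    (hl₁ : 0 < l₁) (hl₁' : l₁ < 1) (hl₂ : 0 < l₂) (hl₂' : l₂ < 1)
    (hp₁ : 0 ≤ p₁) (hp₁' : p₁ < 1) (hp₂ : 0 ≤ p₂) (hp₂' : p₂ ≤ 1) :
    -- queue 2 evolves, whatever queue 1 contains, as a chain of its own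
    (∀ (q : ℕ) (z z' : State₂),
      HasSum (fun q' : ℕ => sysTrans l₁ l₂ p₁ p₂ (q, z) (q', z')) (trans₂ l₂ p₁ p₂ z z')) ∧
    -- which is a homogeneous quasi-birth-death chain
    IsHomogeneousQBD (trans₂ l₂ p₁ p₂)
      (blockB l₂ p₁ p₂) (blockA₀ l₂ p₁ p₂) (blockA₁ l₂ p₁ p₂) (blockA₂ l₂ p₁ p₂) ∧
    -- the matrix R, its spectral radius, and what sp(R) < 1 means
    (0 < p₂ →
      SolvesRateEquation (blockA₀ l₂ p₁ p₂) (blockA₁ l₂ p₁ p₂) (blockA₂ l₂ p₁ p₂)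
        (rateR l₂ p₁ p₂) ∧
      sp (rateR l₂ p₁ p₂) = ENNReal.ofReal
        (l₂ * (1 - p₂ - l₂ * p₁ * p₂ + 2 * p₁ * p₂ +
            Real.sqrt (1 - 2 * p₂ + p₂ ^ 2 + 4 * p₁ * p₂ - 2 * l₂ * p₁ * p₂
              - 2 * l₂ * p₁ * p₂ ^ 2 + l₂ ^ 2 * p₁ ^ 2 * p₂ ^ 2)) /
          (2 * p₂ * (1 - l₂ - p₁ + l₂ * p₁))) ∧
      (Stable (trans₂ l₂ p₁ p₂) (0, 0) ↔ sp (rateR l₂ p₁ p₂) < 1) ∧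
      (sp (rateR l₂ p₁ p₂) < 1 ↔ l₂ < p₂ * (1 - p₁) / (1 + p₁ * p₂))) ∧
    -- stability of queue 2
    (Stable (trans₂ l₂ p₁ p₂) (0, 0) ↔ l₂ < p₂ * (1 - p₁) / (1 + p₁ * p₂)) ∧
    ((∃ v, IsStationary (trans₂ l₂ p₁ p₂) v) ↔ l₂ < p₂ * (1 - p₁) / (1 + p₁ * p₂)) ∧
    -- in the stable case R is the rate matrix
    (l₂ < p₂ * (1 - p₁) / (1 + p₁ * p₂) →
      IsRateMatrix (blockA₀ l₂ p₁ p₂) (blockA₁ l₂ p₁ p₂) (blockA₂ l₂ p₁ p₂)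
        (rateR l₂ p₁ p₂)) ∧
    -- the stationary distribution of queue 2, and the resulting service rate of queue 1
    (∀ v, IsStationary (trans₂ l₂ p₁ p₂) v →
      v (0, 0) = (p₂ - l₂ - p₁ * p₂ - l₂ * p₁ * p₂) / ((1 - l₂) * (1 - p₁) * p₂) ∧
      v (0, 1) = 0 ∧
      (∀ k : ℕ, (fun i : Fin 2 => v (k, i)) =
        (rateR l₂ p₁ p₂ ^ k).mulVec (fun i : Fin 2 => v (0, i))) ∧
      HasSum (fun z => v z * serviceProb₁ l₂ p₁ p₂ z)
        (p₁ * (1 - p₁ - l₂ * p₁) / (1 - p₁))) ∧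
    -- stability of the whole system
    (Stable (sysTrans l₁ l₂ p₁ p₂) (0, (0, 0)) ↔
      l₁ < p₁ * (1 - p₁ - l₂ * p₁) / (1 - p₁) ∧ l₂ < p₂ * (1 - p₁) / (1 + p₁ * p₂)) := by
  have hst := stable_trans₂_iff hl₂ hl₂' hp₁ hp₁' hp₂ hp₂'
  have hex := exists_isStationary_trans₂_iff hl₂ hl₂' hp₁ hp₁' hp₂ hp₂'
  refine ⟨hasSum_sysTrans_fst l₁ l₂ p₁ p₂, isHomogeneousQBD_trans₂ l₂ p₁ p₂, fun hp => ?_, hst,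
    hex, fun h => ?_, fun v hv => ?_, ?_⟩
  · obtain ⟨hsp, hcrit⟩ := sp_rateR hl₂ hl₂' hp₁ hp₁' hp hp₂'
    exact ⟨rateR_solves hl₂' hp₁' hp, hsp, hst.trans hcrit.symm, hcrit⟩
  · obtain ⟨v, hv⟩ := hex.2 h
    obtain ⟨hp, hκ, -⟩ := hv.trans₂_critical hl₂ hl₂' hp₁' hp₂
    exact rateR_isRateMatrix hl₂ hl₂' hp₁ hp₁' hp hp₂' hκ
  · obtain ⟨hp, -, -⟩ := hv.trans₂_critical hl₂ hl₂' hp₁' hp₂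
    refine ⟨?_, (isStationary_trans₂_recurrence hv).1,
      isStationary_trans₂_eq_rateR_pow hl₂' hp₁' hp hv,
      hv.hasSum_serviceProb₁ hl₂ hl₂' hp₁ hp₁' hp₂⟩
    have h1 : 0 < 1 - l₂ := sub_pos.2 hl₂'
    have h2 : 0 < 1 - p₁ := sub_pos.2 hp₁'
    rw [eq_div_iff (by positivity), mul_comm]
    exact hv.trans₂_sums.1
  · rw [stable_sysTrans_iff hl₁ hl₁' hl₂ hl₂' hp₁ hp₁' hp₂ hp₂', hex]
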